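/- A descending plane partition (DPP) is a (possibly empty) array of positive integers $a_{i,j}$, $1\le i\le r$, $i\le j\le \mu_i$, whose rows are non-empty, with $\mu_1\ge\mu_2\ge\dots\ge\mu_r$, and such that, with $\lambda_i=\mu_i-i+1$ the number of parts of row $i$ and $\lambda_0=\infty$, $$a_{i,j}\ge a_{i,j+1},\qquad a_{i,j}>a_{i+1,j},\qquad \lambda_i<a_{i,i}\le\lambda_{i-1}$$ whenever the entries involved exist. It is of order $n$ if all its parts satisfy $a_{i,j}\le n$. A part is special if $a_{i,j}\le j-i$. Let $S(A)$, $NS(A)$ be the numbers of special and of non-special parts of $A$, let $M(A)$ be the number of parts equal to $n$, and put $$Z^{(n)}_{DPP}(x,y,z)=\sum_{A\text{ DPP of order }n}x^{S(A)}y^{NS(A)}z^{M(A)}.$$ **Theorem.** Let $n\ge1$, and let $x,y,z,\nu$ be elements of a commutative ring with $$x\,\nu(1-\nu)=\nu+y(1-\nu).$$ Then $$\bigl(1+\nu(z-1)\bigr)\,Z^{(n)}_{DPP}(x,y,z)=\det\bigl((M'_{DPP})_{i,j}\bigr)_{0\le i,j\le n-1},$$ where $M'_{DPP}$ is the infinite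 matrix, depending on $n$, whose double generating function $f_{M'_{DPP}}(u,v)=\sum_{i,j\ge0}(M'_{DPP})_{i,j}u^iv^j$ is the formal power series $$f_{M'_{DPP}}(u,v)=\frac1{1-uv}+\frac1{1-u}\,\frac{yu}{1-xu-v-(y-x)uv}+(z-1)\,\frac{1-v}{1-u}\,\frac{yu+\nu(1-xu)}{1-(y(z-1)+x)u}\left(1+\frac{yu}{1-xu}\right)^{n}v^{n-1}.$$ -/

import Mathlib

/-- A descending plane partition: an array of positive integers `a i j`, for `1 ≤ i ≤ r` and
`i ≤ j ≤ μ i`, arranged in `r` nonempty shifted rows.  Row and column indices start at `1`.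
The row ends `μ i` and the entries `a i j` are set to `0` outside of the array, so that two
descending plane partitions are equal exactly when they are equal as arrays.
The number of parts in row `i` is `μ i + 1 - i`. -/
@[ext]
structure DescendingPlanePartition where
  /-- the number of rows -/
  r : ℕ
  /-- the column in which each row ends -/
  μ : ℕ → ℕ
  /-- the parts -/
  a : ℕ → ℕ → ℕ
  μ_eq_zero : ∀ i, ¬ (1 ≤ i ∧ i ≤ r) → μ i = 0
  a_eq_zero : ∀ i j, ¬ (1 ≤ i ∧ i ≤ r ∧ i ≤ j ∧ j ≤ μ i) → a i j = 0
  row_nonempty : ∀ i, 1 ≤ i → i ≤ r → i ≤ μ i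
  a_pos : ∀ i j, 1 ≤ i → i ≤ r → i ≤ j → j ≤ μ i → 1 ≤ a i j
  /-- the row ends decrease weakly (equivalently, the row lengths decrease strictly) -/
  μ_anti : ∀ i, 1 ≤ i → i + 1 ≤ r → μ (i + 1) ≤ μ i
  /-- the parts decrease weakly along rows -/
  row_weak : ∀ i j, 1 ≤ i → i ≤ r → i ≤ j → j + 1 ≤ μ i → a i (j + 1) ≤ a i j
  /-- the parts decrease strictly down columns -/
  col_strict : ∀ i j, 1 ≤ i → i + 1 ≤ r → i + 1 ≤ j → j ≤ μ (i + 1) → a (i + 1) j < a i j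
  /-- the first part of a row exceeds the number of parts in that row -/
  rowLength_lt : ∀ i, 1 ≤ i → i ≤ r → μ i + 1 - i < a i i
  /-- the first part of a row is at most the number of parts in the preceding row -/
  le_rowLength : ∀ i, 1 ≤ i → i + 1 ≤ r → a (i + 1) (i + 1) ≤ μ i + 1 - i

namespace DescendingPlanePartition

/-- The positions `(i, j)` of the parts. -/
def cells (A : DescendingPlanePartition) : Finset (Σ _ : ℕ, ℕ) :=
  (Finset.Icc 1 A.r).sigma fun i => Finset.Icc i (A.μ i)

/-- All parts are at most `n`. -/
def IsOfOrder (A : DescendingPlanePartition) (n : ℕ) : Prop :=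
  ∀ p ∈ A.cells, A.a p.1 p.2 ≤ n

/-- The number of special parts, i.e. of parts with `a i j ≤ j - i`. -/
def numSpecial (A : DescendingPlanePartition) : ℕ :=
  (A.cells.filter fun p => A.a p.1 p.2 ≤ p.2 - p.1).card

/-- The number of non-special parts. -/
def numNonspecial (A : DescendingPlanePartition) : ℕ :=
  (A.cells.filter fun p => ¬ A.a p.1 p.2 ≤ p.2 - p.1).card

/-- The number of parts equal to `n`. -/
def numMax (A : DescendingPlanePartition) (n : ℕ) : ℕ :=
  (A.cells.filter fun p => A.a p.1 p.2 = n).card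

theorem IsOfOrder.a_le {A : DescendingPlanePartition} {n : ℕ} (h : A.IsOfOrder n) (i j : ℕ) :
    A.a i j ≤ n := by
  by_cases hc : 1 ≤ i ∧ i ≤ A.r ∧ i ≤ j ∧ j ≤ A.μ i
  · exact h ⟨i, j⟩ (by simp [cells]; omega)
  · rw [A.a_eq_zero i j hc]; exact Nat.zero_le _

theorem IsOfOrder.μ_le {A : DescendingPlanePartition} {n : ℕ} (h : A.IsOfOrder n) (i : ℕ) :
    A.μ i ≤ n := by
  by_cases hc : 1 ≤ i ∧ i ≤ A.r
  · obtain ⟨h1, h2⟩ := hc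
    induction i, h1 using Nat.le_induction with
    | base =>
      have := A.rowLength_lt 1 le_rfl h2
      have := h.a_le 1 1
      omega
    | succ i hi ih => exact (A.μ_anti i hi h2).trans (ih (by omega))
  · rw [A.μ_eq_zero i hc]; exact Nat.zero_le _

theorem IsOfOrder.r_le {A : DescendingPlanePartition} {n : ℕ} (h : A.IsOfOrder n) : A.r ≤ n := by
  by_cases hr : 1 ≤ A.r
  · exact (A.row_nonempty A.r hr le_rfl).trans (h.μ_le _)
  · omega

/-- There are finitely many descending plane partitions of order `n`. -/
instance finite_ofOrder (n : ℕ) : Finite {A : DescendingPlanePartition // A.IsOfOrder n} := by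
  let f : {A : DescendingPlanePartition // A.IsOfOrder n} →
      Fin (n + 1) × (Fin (n + 1) → Fin (n + 1)) × (Fin (n + 1) → Fin (n + 1) → Fin (n + 1)) :=
    fun A => (⟨A.1.r, Nat.lt_succ_of_le A.2.r_le⟩,
      fun i => ⟨A.1.μ i, Nat.lt_succ_of_le (A.2.μ_le i)⟩,
      fun i j => ⟨A.1.a i j, Nat.lt_succ_of_le (A.2.a_le i j)⟩)
  refine Finite.of_injective f ?_
  rintro ⟨A, hA⟩ ⟨B, hB⟩ hAB
  simp only [f, Prod.mk.injEq, Fin.mk.injEq, funext_iff] at hAB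
  obtain ⟨h1, h2, h3⟩ := hAB
  have hAr := hA.r_le
  have hBr := hB.r_le
  refine Subtype.ext (DescendingPlanePartition.ext h1 (funext fun i => ?_)
    (funext fun i => funext fun j => ?_))
  · by_cases hi : i < n + 1
    · exact h2 ⟨i, hi⟩
    · rw [A.μ_eq_zero i (by omega), B.μ_eq_zero i (by omega)]
  · by_cases hij : i < n + 1 ∧ j < n + 1
    · exact h3 ⟨i, hij.1⟩ ⟨j, hij.2⟩
    · have := hA.μ_le i
      have := hB.μ_le i
      rw [A.a_eq_zero i j (by omega), B.a_eq_zero i j (by omega)]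

noncomputable instance fintypeOfOrder (n : ℕ) :
    Fintype {A : DescendingPlanePartition // A.IsOfOrder n} :=
  Fintype.ofFinite _

end DescendingPlanePartition

/-- The partition function `Z_DPP^{(n)}(x, y, z)`: the sum over all descending plane partitions of
order `n`, with weight `x` per special part, `y` per non-special part, and an additional `z` per
part equal to `n`. -/
noncomputable def ZDPP {R : Type*} [CommRing R] (n : ℕ) (x y z : R) : R :=
  ∑ A : {A : DescendingPlanePartition // A.IsOfOrder n},
    x ^ A.1.numSpecial * y ^ A.1.numNonspecial * z ^ A.1.numMax n

/-- The formal power series `1 / φ` in the two variables `u`, `v`, for `φ` with constant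
coefficient `1`. -/
noncomputable def recip {R : Type*} [CommRing R] (φ : MvPowerSeries (Fin 2) R) :
    MvPowerSeries (Fin 2) R :=
  MvPowerSeries.invOfUnit φ 1

theorem mul_recip {R : Type*} [CommRing R] (φ : MvPowerSeries (Fin 2) R)
    (h : MvPowerSeries.constantCoeff φ = 1) : φ * recip φ = 1 :=
  MvPowerSeries.mul_invOfUnit φ 1 (by simpa using h)

/-- The double generating function `f_{M'_DPP}(u, v)`, as a formal power series in `u`, `v`. All the
denominators have constant coefficient `1`. It is meant for `n ≥ 1`. -/
noncomputable def genFunDPP' {R : Type*} [CommRing R] (n : ℕ) (x y z ν : R) :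
    MvPowerSeries (Fin 2) R :=
  let u : MvPowerSeries (Fin 2) R := MvPowerSeries.X 0
  let v : MvPowerSeries (Fin 2) R := MvPowerSeries.X 1
  let c : R → MvPowerSeries (Fin 2) R := fun t => MvPowerSeries.C t
  recip (1 - u * v)
    + recip (1 - u) * (c y * u * recip (1 - c x * u - v - c (y - x) * u * v))
    + c (z - 1) * ((1 - v) * recip (1 - u))
        * ((c y * u + c ν * (1 - c x * u)) * recip (1 - c (y * (z - 1) + x) * u))
        * (1 + c y * u * recip (1 - c x * u)) ^ n * v ^ (n - 1)

/-- The infinite matrix `M'_DPP`, with rows and columns indexed from `0`: its entry `(i, j)` is the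
coefficient of `u ^ i * v ^ j` in the double generating function. -/
noncomputable def MDPP' {R : Type*} [CommRing R] (n : ℕ) (x y z ν : R) : Matrix ℕ ℕ R :=
  fun i j => MvPowerSeries.coeff (Finsupp.single 0 i + Finsupp.single 1 j) (genFunDPP' n x y z ν)

/-- The truncation of an infinite matrix to its first `n` rows and columns. -/
def truncate {R : Type*} (M : Matrix ℕ ℕ R) (n : ℕ) : Matrix (Fin n) (Fin n) R :=
  M.submatrix (fun i => (i : ℕ)) (fun j => (j : ℕ))

/-! Label each row of a descending plane partition by its length and read it as a lattice path whose
height in position `q` is the part there. The column conditions say that the paths of different rows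
do not intersect. The condition `λ_i < a_{i,i} ≤ λ_{i-1}` ties the starting heights to the lengths:
a set `S` of row lengths, enlarged by `0`, fixes the ends of the paths and, through `nextEnd`, the
bounds on their starts (`n` for the longest row).

For fixed `S` the weighted count is a determinant of single-path weights (`det_nextEnd`). In place
of a sign-reversing involution, subtracting neighbouring rows and expanding multilinearly peels off
one column of parts at a time (`det_pathMatrix_eq_det_pathDiffMatrix`, `det_pathDiffMatrix`). The
starting heights are the ends moved one step cyclically within `S`, so up to sign these determinants
are principal minors of one matrix. Subtracting a shifted identity generates the sum of all those
with `0 ∈ S` (`det_sub_shift`).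

The path weights have explicit generating functions. Put `s = X / (1 - x X)` and `c = 1 + y s`. From
position `0` and height `h < n` the series is `c ^ h`; from height `n` it is `c ^ n / (1 - (z - 1) y
s)` up to degree `n - 1`. On the other side, multiplying the generating function of `M'_DPP` by `1 -
u` and telescoping the columns turns column `j` into `c ^ (j + 1) - X ^ (j + 1)`. In the last column
the extra term supplies the denominator `1 - (z - 1) y s` together with the factor `1 + ν (z - 1)`
(`det_truncate_MDPP'`). -/

/-! ### Columns of a bivariate generating function as power series in `u`. -/

section ColumnSeries

variable {R : Type*} [CommRing R]

/-- The coefficient of `v ^ j` in a bivariate power series, as a power series in `u`. -/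
noncomputable def colSeries (j : ℕ) : MvPowerSeries (Fin 2) R →+ PowerSeries R where
  toFun F := PowerSeries.mk fun i =>
    MvPowerSeries.coeff (Finsupp.single 0 i + Finsupp.single 1 j) F
  map_zero' := by ext; simp
  map_add' F G := by ext; simp

theorem coeff_colSeries (i j : ℕ) (F : MvPowerSeries (Fin 2) R) :
    PowerSeries.coeff i (colSeries j F) =
      MvPowerSeries.coeff (Finsupp.single 0 i + Finsupp.single 1 j) F := by
  simp [colSeries]

theorem colSeries_C_mul (j : ℕ) (r : R) (F : MvPowerSeries (Fin 2) R) :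
    colSeries j (MvPowerSeries.C r * F) = PowerSeries.C r * colSeries j F := by
  ext i
  simp [coeff_colSeries]

theorem colSeries_u_mul (j : ℕ) (F : MvPowerSeries (Fin 2) R) :
    colSeries j (MvPowerSeries.X 0 * F) = PowerSeries.X * colSeries j F := by
  ext i
  cases i with
  | zero =>
    rw [coeff_colSeries, MvPowerSeries.X_def, MvPowerSeries.coeff_monomial_mul, if_neg]
    · simp
    · intro h
      simpa using h 0
  | succ i =>
    rw [PowerSeries.coeff_succ_X_mul, coeff_colSeries, coeff_colSeries, MvPowerSeries.X_def,
      show (Finsupp.single 0 (i + 1) + Finsupp.single 1 j : Fin 2 →₀ ℕ) =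
        Finsupp.single 0 1 + (Finsupp.single 0 i + Finsupp.single 1 j) by
          rw [← add_assoc, ← Finsupp.single_add, add_comm 1],
      MvPowerSeries.coeff_add_monomial_mul, one_mul]

theorem colSeries_zero_v_mul (F : MvPowerSeries (Fin 2) R) :
    colSeries 0 (MvPowerSeries.X 1 * F) = 0 := by
  ext i
  rw [coeff_colSeries, MvPowerSeries.X_def, MvPowerSeries.coeff_monomial_mul, if_neg]
  · simp
  · intro h
    simpa using h 1

theorem colSeries_succ_v_mul (j : ℕ) (F : MvPowerSeries (Fin 2) R) :
    colSeries (j + 1) (MvPowerSeries.X 1 * F) = colSeries j F := by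
  ext i
  rw [coeff_colSeries, coeff_colSeries, MvPowerSeries.X_def,
    show (Finsupp.single 0 i + Finsupp.single 1 (j + 1) : Fin 2 →₀ ℕ) =
      Finsupp.single 1 1 + (Finsupp.single 0 i + Finsupp.single 1 j) by
        rw [Finsupp.single_add]; abel,
    MvPowerSeries.coeff_add_monomial_mul, one_mul]

theorem colSeries_v_pow_mul (j m : ℕ) (F : MvPowerSeries (Fin 2) R) :
    colSeries j (MvPowerSeries.X 1 ^ m * F) = if m ≤ j then colSeries (j - m) F else 0 := by
  induction m generalizing j with
  | zero => simp
  | succ m ih =>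
    rw [pow_succ', mul_assoc]
    cases j with
    | zero => simp [colSeries_zero_v_mul]
    | succ j => rw [colSeries_succ_v_mul, ih]; simp

theorem colSeries_one (j : ℕ) :
    colSeries j (1 : MvPowerSeries (Fin 2) R) = if j = 0 then 1 else 0 := by
  classical
  ext i
  rw [coeff_colSeries, MvPowerSeries.coeff_one]
  rcases Nat.eq_zero_or_pos j with rfl | hj
  · simp [PowerSeries.coeff_one]
  · rw [if_neg, if_neg hj.ne', map_zero]
    intro h
    have := DFunLike.congr_fun h 1
    simp at this
    omega

/-- The series `F` involves only `u`, and is `a` as a series in `u`: expressed by the action of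
multiplication by `F` on columns. -/
def ActsAs (F : MvPowerSeries (Fin 2) R) (a : PowerSeries R) : Prop :=
  ∀ G j, colSeries j (F * G) = a * colSeries j G

namespace ActsAs

variable {F F' : MvPowerSeries (Fin 2) R} {a a' : PowerSeries R}

theorem u : ActsAs (MvPowerSeries.X 0 : MvPowerSeries (Fin 2) R) PowerSeries.X :=
  fun G j => colSeries_u_mul j G

theorem C (r : R) : ActsAs (MvPowerSeries.C r) (PowerSeries.C r) :=
  fun G j => colSeries_C_mul j r G

theorem one : ActsAs (1 : MvPowerSeries (Fin 2) R) 1 := fun G j => by simp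

theorem add (h : ActsAs F a) (h' : ActsAs F' a') : ActsAs (F + F') (a + a') := fun G j => by
  rw [add_mul, add_mul, map_add, h, h']

theorem sub (h : ActsAs F a) (h' : ActsAs F' a') : ActsAs (F - F') (a - a') := fun G j => by
  rw [sub_mul, sub_mul, map_sub, h, h']

theorem mul (h : ActsAs F a) (h' : ActsAs F' a') : ActsAs (F * F') (a * a') := fun G j => by
  rw [mul_assoc, mul_assoc, h, h']

theorem pow (h : ActsAs F a) (n : ℕ) : ActsAs (F ^ n) (a ^ n) := by
  induction n with
  | zero => simpa using one
  | succ n ih => rw [pow_succ, pow_succ]; exact ih.mul h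

theorem of_mul_eq_one (h : ActsAs F a) (hF : F * F' = 1) (ha : a * a' = 1) : ActsAs F' a' :=
  fun G j => by
    have h1 := h (F' * G) j
    rw [← mul_assoc, hF, one_mul] at h1
    rw [h1, ← mul_assoc, mul_comm a', ha, one_mul]

end ActsAs

/-- The power series `1 / (1 - r X)`. -/
noncomputable def geomSeries (r : R) : PowerSeries R := PowerSeries.mk fun n => r ^ n

theorem one_sub_mul_geomSeries (r : R) :
    (1 - PowerSeries.C r * PowerSeries.X) * geomSeries r = 1 := by
  ext i
  rw [sub_mul, one_mul, mul_assoc, map_sub, PowerSeries.coeff_C_mul]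
  cases i with
  | zero => simp [geomSeries]
  | succ i =>
    rw [PowerSeries.coeff_succ_X_mul]
    simp [geomSeries, PowerSeries.coeff_one, pow_succ']

theorem constantCoeff_geomSeries (r : R) : PowerSeries.constantCoeff (geomSeries r) = 1 := by
  rw [← PowerSeries.coeff_zero_eq_constantCoeff_apply]
  simp [geomSeries]

theorem ActsAs.recip_one_sub (r : R) :
    ActsAs (recip (1 - MvPowerSeries.C r * MvPowerSeries.X 0)) (geomSeries r) :=
  (ActsAs.one.sub ((ActsAs.C r).mul ActsAs.u)).of_mul_eq_one
    (mul_recip _ (by simp)) (one_sub_mul_geomSeries r)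

theorem colSeries_recip_one_sub_uv (j : ℕ) :
    colSeries j (recip (1 - MvPowerSeries.X 0 * MvPowerSeries.X 1 : MvPowerSeries (Fin 2) R)) =
      PowerSeries.X ^ j := by
  set H := recip (1 - MvPowerSeries.X 0 * MvPowerSeries.X 1 : MvPowerSeries (Fin 2) R) with hH
  have h1 : H = 1 + MvPowerSeries.X 0 * (MvPowerSeries.X 1 * H) := by
    have := mul_recip (1 - MvPowerSeries.X 0 * MvPowerSeries.X 1 : MvPowerSeries (Fin 2) R)
      (by simp)
    rw [← hH] at this
    linear_combination this
  induction j with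
  | zero =>
    rw [h1, map_add, colSeries_one, colSeries_u_mul, colSeries_zero_v_mul]
    simp
  | succ j ih =>
    rw [h1, map_add, colSeries_one, colSeries_u_mul, colSeries_succ_v_mul, ih]
    simp [pow_succ']

/-- The series `X / (1 - x X)`. -/
noncomputable def stepSeries (x : R) : PowerSeries R := PowerSeries.X * geomSeries x

/-- The series `1 + y X / (1 - x X)`. -/
noncomputable def climbSeries (x y : R) : PowerSeries R := 1 + PowerSeries.C y * stepSeries x

theorem one_sub_mul_climbSeries (x y : R) :
    (1 - PowerSeries.C x * PowerSeries.X) * climbSeries x y =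
      1 + PowerSeries.C (y - x) * PowerSeries.X := by
  have := one_sub_mul_geomSeries x
  rw [climbSeries, stepSeries, map_sub]
  linear_combination (PowerSeries.C y * PowerSeries.X) * this

/-- The denominator is `(1 - x u) - v (1 + (y - x) u)`, so its reciprocal is a geometric series in
`v`. The ratio `(1 + (y - x) u) / (1 - x u)` is `climbSeries`. -/
theorem colSeries_recip_quadratic (x y : R) (j : ℕ) :
    colSeries j (recip (1 - MvPowerSeries.C x * MvPowerSeries.X 0 - MvPowerSeries.X 1
      - MvPowerSeries.C (y - x) * MvPowerSeries.X 0 * MvPowerSeries.X 1)) =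
      climbSeries x y ^ j * geomSeries x := by
  set φ := (1 - MvPowerSeries.C x * MvPowerSeries.X 0 - MvPowerSeries.X 1
      - MvPowerSeries.C (y - x) * MvPowerSeries.X 0 * MvPowerSeries.X 1 :
        MvPowerSeries (Fin 2) R) with hφ
  have h1 : (1 - MvPowerSeries.C x * MvPowerSeries.X 0) * recip φ =
      1 + MvPowerSeries.X 1 *
        ((1 + MvPowerSeries.C (y - x) * MvPowerSeries.X 0) * recip φ) := by
    have := mul_recip φ (by simp [hφ])
    nth_rw 1 [hφ] at this
    linear_combination this
  have hA : ActsAs (1 - MvPowerSeries.C x * MvPowerSeries.X 0)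
      (1 - PowerSeries.C x * PowerSeries.X) := ActsAs.one.sub ((ActsAs.C x).mul ActsAs.u)
  have hB : ActsAs (1 + MvPowerSeries.C (y - x) * MvPowerSeries.X 0)
      (1 + PowerSeries.C (y - x) * PowerSeries.X) :=
    ActsAs.one.add ((ActsAs.C (y - x)).mul ActsAs.u)
  have hg := one_sub_mul_geomSeries x
  have hc := one_sub_mul_climbSeries x y
  induction j with
  | zero =>
    have h2 := congrArg (colSeries 0) h1
    rw [hA, map_add, colSeries_zero_v_mul, colSeries_one] at h2
    simp only [if_true, add_zero] at h2
    linear_combination geomSeries x * h2 - colSeries 0 (recip φ) * hg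
  | succ j ih =>
    have h2 := congrArg (colSeries (j + 1)) h1
    rw [hA, map_add, colSeries_succ_v_mul, hB, colSeries_one, ih] at h2
    simp only [Nat.succ_ne_zero, if_false, zero_add] at h2
    linear_combination geomSeries x * h2 - colSeries (j + 1) (recip φ) * hg
      - climbSeries x y ^ j * geomSeries x ^ 2 * hc
      + climbSeries x y ^ (j + 1) * geomSeries x * hg

end ColumnSeries

/-! ### Determinants of truncated coefficient matrices. -/

section Determinant

variable {R : Type*} [CommRing R]

/-- The square matrix whose columns are the coefficients of the given power series. -/
noncomputable def coeffMatrix (n : ℕ) (K : ℕ → PowerSeries R) : Matrix (Fin n) (Fin n) R :=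
  Matrix.of fun i j => PowerSeries.coeff i (K j)

/-- Multiplication by `a` acts on coefficients as a lower unitriangular Toeplitz matrix, and lower
triangularity makes this compatible with truncation. -/
theorem det_coeffMatrix_mul (n : ℕ) (a : PowerSeries R) (ha : PowerSeries.constantCoeff a = 1)
    (K : ℕ → PowerSeries R) :
    (coeffMatrix n fun j => a * K j).det = (coeffMatrix n K).det := by
  let T : Matrix (Fin n) (Fin n) R :=
    Matrix.of fun i k => if k ≤ i then PowerSeries.coeff ((i : ℕ) - k) a else 0
  have hT : T.det = 1 := by
    rw [Matrix.det_of_isLowerTriangular]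
    · refine Finset.prod_eq_one fun i _ => ?_
      simp [T, ha]
    · intro i k hik
      simp only [T, Matrix.of_apply]
      rw [if_neg]
      exact not_le.mpr hik
  have hmul : (coeffMatrix n fun j => a * K j) = T * coeffMatrix n K := by
    ext i j
    rw [Matrix.mul_apply]
    simp only [coeffMatrix, T, Matrix.of_apply]
    rw [PowerSeries.coeff_mul, Finset.Nat.sum_antidiagonal_eq_sum_range_succ_mk,
      ← Finset.sum_range_reflect]
    have : ∀ k : Fin n, (if k ≤ i then PowerSeries.coeff ((i : ℕ) - k) a else 0) *
        PowerSeries.coeff (k : ℕ) (K j) = (fun k : ℕ => if k ≤ (i : ℕ) then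
          PowerSeries.coeff ((i : ℕ) - k) a * PowerSeries.coeff k (K j) else 0) k := by
      intro k
      by_cases h : k ≤ i
      · simp [h]
      · simp [h]
    rw [Finset.sum_congr rfl fun k _ => this k,
      Fin.sum_univ_eq_sum_range (fun k : ℕ => if k ≤ (i : ℕ) then
          PowerSeries.coeff ((i : ℕ) - k) a * PowerSeries.coeff k (K j) else 0) n,
      ← Finset.sum_subset (Finset.range_subset_range.2 (Nat.succ_le_of_lt i.2))]
    · refine Finset.sum_congr rfl fun k hk => ?_
      have hk : k ≤ (i : ℕ) := by simpa [Nat.lt_succ_iff] using hk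
      rw [if_pos hk]
      rw [show (i : ℕ).succ - 1 - k = i - k by omega, Nat.sub_sub_self hk]
    · intro k _ hk
      rw [if_neg]
      simpa using hk
  rw [hmul, Matrix.det_mul, hT, one_mul]

theorem det_coeffMatrix_sub_pred (n : ℕ) (K L : ℕ → PowerSeries R) (h0 : L 0 = K 0)
    (hL : ∀ j, j + 1 < n → L (j + 1) = K (j + 1) - K j) :
    (coeffMatrix n L).det = (coeffMatrix n K).det := by
  cases n with
  | zero => simp
  | succ n =>
    symm
    refine Matrix.det_eq_of_forall_col_eq_smul_add_pred (fun _ => 1) (fun i => ?_) fun i j => ?_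
    · simp [coeffMatrix, h0]
    · simp only [coeffMatrix, Matrix.of_apply, Fin.val_succ, Fin.val_castSucc]
      rw [hL j (by omega), map_sub]
      ring

theorem det_coeffMatrix_congr (n : ℕ) {K L : ℕ → PowerSeries R}
    (h : ∀ i < n, ∀ j < n, PowerSeries.coeff i (K j) = PowerSeries.coeff i (L j)) :
    (coeffMatrix n K).det = (coeffMatrix n L).det := by
  congr 1
  ext i j
  exact h i i.2 j j.2

theorem det_coeffMatrix_C_mul_last (m : ℕ) (r : R) (K : ℕ → PowerSeries R) :
    (coeffMatrix (m + 1) fun j => if j = m then PowerSeries.C r * K j else K j).det =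
      r * (coeffMatrix (m + 1) K).det := by
  have h1 : (coeffMatrix (m + 1) fun j => if j = m then PowerSeries.C r * K j else K j) =
      (coeffMatrix (m + 1) K).updateCol (Fin.last m)
        (r • fun i => coeffMatrix (m + 1) K i (Fin.last m)) := by
    ext i j
    rw [Matrix.updateCol_apply]
    by_cases h : j = Fin.last m
    · subst h
      simp [coeffMatrix]
    · have h' : (j : ℕ) ≠ m := fun h' => h (Fin.ext h')
      simp [coeffMatrix, h, h']
  rw [h1, Matrix.det_updateCol_smul]
  congr 2
  exact Matrix.updateCol_eq_self _ _

end Determinant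

/-! ### Generating functions of single paths, and reduction of `M'_DPP` to path weights. -/

section PathSeries

variable {R : Type*} [CommRing R]

/-- The generating function of the paths that start with value at most `h` at position `p`: the
coefficient of `X ^ e` counts the weakly decreasing sequences of positive integers at most `h`
in the positions `p, ..., e - 1`, by special and non-special parts. -/
noncomputable def pathSeries (x y : R) (p h : ℕ) : PowerSeries R :=
  if p ≤ h then stepSeries x ^ p * climbSeries x y ^ (h - p)
  else PowerSeries.X ^ p * geomSeries x ^ h

/-- The variant of `pathSeries` for `h = n`, with parts equal to `n` weighted by `z`. -/
noncomputable def topPathSeries (n : ℕ) (x y z : R) (p : ℕ) : PowerSeries R :=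
  ∑ l ∈ Finset.range (n - p),
    PowerSeries.C (z * y) ^ l * (stepSeries x ^ (p + l) * climbSeries x y ^ (n - 1 - p - l))

/-- The weight of a part `v` in position `q` of its row. -/
def partWeight (n : ℕ) (x y z : R) (q v : ℕ) : R :=
  (if v ≤ q then x else y) * (if v = n then z else 1)

/-- The weighted number of weakly decreasing sequences of positive integers at most `h`, in the
positions `p, ..., e - 1`. -/
noncomputable def pathWeight (n : ℕ) (x y z : R) (p h e : ℕ) : R :=
  PowerSeries.coeff e (if h = n then topPathSeries n x y z p else pathSeries x y p h)

/-- Either no part equals `h + 1`, or the part in position `p` does, and the path continues from `p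
+ 1` with the same bound. Together with the empty count at height `0`, this recursion is what
justifies the closed forms as path counts. -/
theorem pathSeries_succ (x y : R) (p h : ℕ) :
    pathSeries x y p (h + 1) = pathSeries x y p h +
      PowerSeries.C (if h + 1 ≤ p then x else y) * pathSeries x y (p + 1) (h + 1) := by
  have hg := one_sub_mul_geomSeries x
  rcases lt_trichotomy p (h + 1) with hp | hp | hp
  · rw [pathSeries, pathSeries, pathSeries, if_pos hp.le, if_pos (by omega), if_neg (by omega),
      if_pos (by omega), show h + 1 - p = (h - p) + 1 by omega,
      show h + 1 - (p + 1) = h - p by omega]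
    rw [pow_succ, pow_succ, climbSeries]
    ring
  · subst hp
    rw [pathSeries, pathSeries, pathSeries, if_pos le_rfl, if_neg (by omega), if_pos le_rfl,
      if_neg (by omega), Nat.sub_self, stepSeries, mul_pow, pow_zero, mul_one]
    linear_combination (PowerSeries.X ^ (h + 1) * geomSeries x ^ h) * hg
  · rw [pathSeries, pathSeries, pathSeries, if_neg (by omega), if_neg (by omega),
      if_pos (by omega), if_neg (by omega)]
    linear_combination (PowerSeries.X ^ p * geomSeries x ^ h) * hg

/-- The index `l` of the defining sum is the number of leading parts equal to `n`. In a position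
below `n` such a part is never special, hence the weight `y * z`. -/
theorem topPathSeries_eq (n : ℕ) (x y z : R) (p : ℕ) (hp : p < n) :
    topPathSeries n x y z p = pathSeries x y p (n - 1) +
      PowerSeries.C (y * z) * topPathSeries n x y z (p + 1) := by
  rw [topPathSeries, show n - p = (n - (p + 1)) + 1 by omega, Finset.sum_range_succ', add_comm,
    topPathSeries, Finset.mul_sum, pathSeries, if_pos (by omega)]
  congr 1
  · simp
  · refine Finset.sum_congr rfl fun l _ => ?_
    rw [show p + 1 + l = p + (l + 1) by omega, show n - 1 - (p + 1) - l = n - 1 - p - (l + 1) by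
      omega, mul_comm y z]
    ring

theorem pathWeight_succ (n : ℕ) (x y z : R) (p h e : ℕ) (hp : p < n) (hh : h < n) :
    pathWeight n x y z p (h + 1) e = pathWeight n x y z p h e +
      partWeight n x y z p (h + 1) * pathWeight n x y z (p + 1) (h + 1) e := by
  rw [pathWeight, pathWeight, pathWeight, if_neg hh.ne]
  by_cases hn : h + 1 = n
  · rw [if_pos hn, if_pos hn, topPathSeries_eq n x y z p hp, partWeight, if_pos hn,
      if_neg (by omega), map_add, PowerSeries.coeff_C_mul, ← hn, Nat.add_sub_cancel]
  · rw [if_neg hn, if_neg hn, pathSeries_succ, partWeight, if_neg hn, map_add,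
      PowerSeries.coeff_C_mul, mul_one]

theorem pathWeight_zero (n : ℕ) (x y z : R) (p e : ℕ) (hn : 0 < n) (he : p < e) :
    pathWeight n x y z p 0 e = 0 := by
  rw [pathWeight, if_neg hn.ne, pathSeries]
  rcases Nat.eq_zero_or_pos p with rfl | hp
  · simp [PowerSeries.coeff_one, he.ne']
  · rw [if_neg (by omega), pow_zero, mul_one, PowerSeries.coeff_X_pow, if_neg he.ne']

theorem constantCoeff_climbSeries (x y : R) :
    PowerSeries.constantCoeff (climbSeries x y) = 1 := by
  simp [climbSeries, stepSeries]

theorem coeff_stepSeries_pow_mul (x : R) (p : ℕ) (a : PowerSeries R) :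
    PowerSeries.coeff p (stepSeries x ^ p * a) = PowerSeries.constantCoeff a := by
  rw [stepSeries, mul_pow, mul_assoc, PowerSeries.coeff_X_pow_mul', if_pos le_rfl]
  simp [constantCoeff_geomSeries]

theorem coeff_pathSeries_self (x y : R) (p h : ℕ) :
    PowerSeries.coeff p (pathSeries x y p h) = 1 := by
  rw [pathSeries]
  split_ifs
  · rw [coeff_stepSeries_pow_mul]
    simp [constantCoeff_climbSeries]
  · rw [PowerSeries.coeff_X_pow_mul', if_pos le_rfl]
    simp [constantCoeff_geomSeries]

theorem coeff_topPathSeries_of_lt (n : ℕ) (x y z : R) (e p : ℕ) (h : e < p) :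
    PowerSeries.coeff e (topPathSeries n x y z p) = 0 := by
  rw [topPathSeries, map_sum]
  refine Finset.sum_eq_zero fun l _ => ?_
  rw [← map_pow, PowerSeries.coeff_C_mul, stepSeries, mul_pow PowerSeries.X,
    mul_assoc (PowerSeries.X ^ _), PowerSeries.coeff_X_pow_mul', if_neg (by omega), mul_zero]

theorem pathWeight_self (n : ℕ) (x y z : R) (p h : ℕ) (hp : p < n) :
    pathWeight n x y z p h p = 1 := by
  rw [pathWeight]
  split_ifs
  · rw [topPathSeries_eq n x y z p hp, map_add, coeff_pathSeries_self, PowerSeries.coeff_C_mul,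
      coeff_topPathSeries_of_lt n x y z p (p + 1) (by omega), mul_zero, add_zero]
  · exact coeff_pathSeries_self x y p h

/-- This is the geometric sum for `c ^ n - (z y s) ^ n`, since `c - z y s = 1 - (z - 1) y s`. -/
theorem topPathSeries_zero_mul (n : ℕ) (x y z : R) :
    topPathSeries n x y z 0 * (1 - PowerSeries.C (z - 1) * (PowerSeries.C y * stepSeries x)) =
      climbSeries x y ^ n - (PowerSeries.C (z * y) * stepSeries x) ^ n := by
  have h := geom_sum₂_mul (PowerSeries.C (z * y) * stepSeries x) (climbSeries x y) n
  have h2 : topPathSeries n x y z 0 = ∑ i ∈ Finset.range n,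
      (PowerSeries.C (z * y) * stepSeries x) ^ i * climbSeries x y ^ (n - 1 - i) := by
    rw [topPathSeries]
    refine Finset.sum_congr (by simp) fun l _ => ?_
    rw [mul_pow, zero_add, Nat.sub_zero, mul_assoc]
  rw [h2]
  rw [show (1 - PowerSeries.C (z - 1) * (PowerSeries.C y * stepSeries x)) =
    -(PowerSeries.C (z * y) * stepSeries x - climbSeries x y) by
      rw [climbSeries, map_sub, map_mul, map_one]; ring]
  linear_combination -h

theorem det_truncate_MDPP' (n : ℕ) (hn : 1 ≤ n) (x y z ν : R) :
    (truncate (MDPP' n x y z ν) n).det = (1 + ν * (z - 1)) *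
      (Matrix.of fun i j : Fin n => pathWeight n x y z 0 (j + 1) i -
        if (i : ℕ) = j + 1 then 1 else 0).det := by
  obtain ⟨m, rfl⟩ : ∃ m, n = m + 1 := ⟨n - 1, by omega⟩
  set c := climbSeries x y with hc
  set t := PowerSeries.C y * stepSeries x with ht
  set g := geomSeries (1 : R) with hg
  set D := geomSeries (y * (z - 1) + x) with hD
  set N : PowerSeries R := PowerSeries.C y * PowerSeries.X +
    PowerSeries.C ν * (1 - PowerSeries.C x * PowerSeries.X) with hN
  have hg1 : (1 - PowerSeries.X) * g = 1 := by simpa using one_sub_mul_geomSeries (1 : R)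
  have hD1 := one_sub_mul_geomSeries (y * (z - 1) + x)
  have hA1 := one_sub_mul_geomSeries x
  rw [← hD] at hD1
  have hgu : ActsAs (recip (1 - MvPowerSeries.X 0 : MvPowerSeries (Fin 2) R)) g := by
    simpa using ActsAs.recip_one_sub (1 : R)
  have hcol : ∀ j, j < m + 1 → colSeries j (genFunDPP' (m + 1) x y z ν) =
      PowerSeries.X ^ j + g * (t * c ^ j) +
        if j = m then PowerSeries.C (z - 1) * (g * (N * D)) * c ^ (m + 1) else 0 := by
    intro j hj
    rw [genFunDPP', map_add, map_add]
    congr 1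
    · congr 1
      · exact colSeries_recip_one_sub_uv j
      · rw [hgu, ((ActsAs.C y).mul ActsAs.u), colSeries_recip_quadratic, ht, stepSeries]
        ring
    · have hact : ActsAs (MvPowerSeries.C (z - 1) * (recip (1 - MvPowerSeries.X 0) *
          ((MvPowerSeries.C y * MvPowerSeries.X 0 + MvPowerSeries.C ν *
            (1 - MvPowerSeries.C x * MvPowerSeries.X 0)) *
            recip (1 - MvPowerSeries.C (y * (z - 1) + x) * MvPowerSeries.X 0))) *
          (1 + MvPowerSeries.C y * MvPowerSeries.X 0 *
            recip (1 - MvPowerSeries.C x * MvPowerSeries.X 0)) ^ (m + 1))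
          (PowerSeries.C (z - 1) * (g * (N * D)) * c ^ (m + 1)) := by
        refine (((ActsAs.C _).mul (hgu.mul (ActsAs.mul ?_ (ActsAs.recip_one_sub _)))).mul
          (ActsAs.pow ?_ _))
        · exact ((ActsAs.C y).mul ActsAs.u).add
            ((ActsAs.C ν).mul (ActsAs.one.sub ((ActsAs.C x).mul ActsAs.u)))
        · rw [hc, climbSeries, stepSeries, ← mul_assoc]
          exact ActsAs.one.add (((ActsAs.C y).mul ActsAs.u).mul (ActsAs.recip_one_sub x))
      -- The factor `(1 - v) v ^ m` is split as `v ^ m - v ^ (m + 1)`: the first term reaches only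
      -- column `m`, the second lies beyond the truncation.
      have hre : ∀ a b d e : MvPowerSeries (Fin 2) R, MvPowerSeries.C (z - 1) *
          ((1 - MvPowerSeries.X 1) * a) * b * d * e =
          (MvPowerSeries.C (z - 1) * (a * b) * d) * (e * 1) -
          (MvPowerSeries.C (z - 1) * (a * b) * d) * (MvPowerSeries.X 1 * e * 1) := by
        intros; ring
      rw [hre, map_sub, hact, hact, Nat.add_sub_cancel, ← pow_succ', colSeries_v_pow_mul,
        colSeries_v_pow_mul, if_neg (show ¬ m + 1 ≤ j by omega), mul_zero, sub_zero]
      by_cases hjm : j = m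
      · rw [if_pos hjm.ge, if_pos hjm, hjm, Nat.sub_self, colSeries_one, if_pos rfl, mul_one]
      · rw [if_neg hjm, if_neg (by omega), mul_zero]
  have h1 : (truncate (MDPP' (m + 1) x y z ν) (m + 1)).det =
      (coeffMatrix (m + 1) fun j => colSeries j (genFunDPP' (m + 1) x y z ν)).det := by
    congr 1
    ext i j
    simp [truncate, MDPP', coeffMatrix, coeff_colSeries]
  -- This clears `g = 1 / (1 - X)` and makes the columns consecutive differences of `κ`, because `t
  -- * c ^ j = c ^ (j + 1) - c ^ j`.
  rw [h1, ← det_coeffMatrix_mul _ (1 - PowerSeries.X) (by simp)]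
  let κ : ℕ → PowerSeries R := fun h => c ^ h - PowerSeries.X ^ h
  let δ : PowerSeries R := PowerSeries.C (z - 1) * (N * D) * c ^ (m + 1)
  have h2 : ∀ j, j < m + 1 → (1 - PowerSeries.X) * colSeries j (genFunDPP' (m + 1) x y z ν) =
      κ (j + 1) - κ j + if j = m then δ else 0 := by
    intro j hj
    rw [hcol j hj]
    have hct : c = 1 + t := rfl
    by_cases hjm : j = m
    · simp only [if_pos hjm, κ, δ, pow_succ (c) j]
      linear_combination (t * c ^ j + PowerSeries.C (z - 1) * (N * D) * c ^ (m + 1)) * hg1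
        - c ^ j * hct
    · simp only [if_neg hjm, κ, pow_succ (c) j]
      linear_combination (t * c ^ j) * hg1 - c ^ j * hct
  -- Partial sums of the columns telescope, starting from `κ 0 = 0`; `δ` occurs only in the last
  -- column, so it is not propagated.
  rw [det_coeffMatrix_sub_pred (m + 1) (fun j => κ (j + 1) + if j = m then δ else 0)]
  · rw [show (Matrix.of fun i j : Fin (m + 1) => pathWeight (m + 1) x y z 0 (j + 1) i -
        if (i : ℕ) = j + 1 then 1 else 0) = coeffMatrix (m + 1) (fun j =>
          if j = m then topPathSeries (m + 1) x y z 0 else κ (j + 1)) from ?_,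
      ← det_coeffMatrix_C_mul_last]
    · refine det_coeffMatrix_congr _ fun i hi j hj => ?_
      by_cases hjm : j = m
      · simp only [if_pos hjm]
        subst hjm
        rw [← sub_eq_zero, ← map_sub]
        refine (PowerSeries.X_pow_dvd_iff (n := j + 1)).1 ?_ i hi
        have hE : (1 - PowerSeries.C x * PowerSeries.X) * D *
            (1 - PowerSeries.C (z - 1) * t) = 1 := by
          rw [ht, stepSeries]
          rw [map_add, map_mul] at hD1
          linear_combination hD1 - PowerSeries.C (z - 1) * PowerSeries.C y * PowerSeries.X * D * hA1
        have hT := topPathSeries_zero_mul (j + 1) x y z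
        rw [← ht, ← hc] at hT
        have hT2 : topPathSeries (j + 1) x y z 0 = (1 - PowerSeries.C x * PowerSeries.X) * D *
            (c ^ (j + 1) - (PowerSeries.C (z * y) * stepSeries x) ^ (j + 1)) := by
          linear_combination (1 - PowerSeries.C x * PowerSeries.X) * D * hT -
            topPathSeries (j + 1) x y z 0 * hE
        have hN' : N = (1 - PowerSeries.C x * PowerSeries.X) * (t + PowerSeries.C ν) := by
          rw [hN, ht, stepSeries]
          linear_combination -PowerSeries.C y * PowerSeries.X * hA1
        -- The two last columns agree only modulo `X ^ (j + 1)`. The quotient collects the term `-X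
        -- ^ (j + 1)` of `κ` and the tail `(z y s) ^ (j + 1)` of the geometric sum.
        refine ⟨-1 + PowerSeries.C (1 + ν * (z - 1)) * (1 - PowerSeries.C x * PowerSeries.X) * D *
          (PowerSeries.C (z * y) * geomSeries x) ^ (j + 1), ?_⟩
        simp only [κ, δ]
        rw [hT2, hN', stepSeries, map_add, map_one, map_mul]
        rw [mul_left_comm (PowerSeries.C (z * y)), mul_pow PowerSeries.X]
        linear_combination -c ^ (j + 1) * hE
      · simp only [if_neg hjm, add_zero]
    · ext i j
      simp only [coeffMatrix, Matrix.of_apply, pathWeight]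
      by_cases hjm : (j : ℕ) = m
      · rw [if_pos (by omega), if_pos hjm, if_neg (by omega), sub_zero]
      · rw [if_neg (by omega), if_neg hjm, pathSeries, if_pos (Nat.zero_le _)]
        simp [κ, hc, PowerSeries.coeff_X_pow]
  · rw [h2 0 (by omega)]
    simp [κ]
  · intro j hj
    rw [h2 _ hj, if_neg (show j ≠ m by omega)]
    ring

end PathSeries

/-! ### Expansion of the determinant over the sets of row lengths. -/

section Expansion

variable {R : Type*} [CommRing R]

/-- The least element of `S ∪ {n}` that exceeds `l`. -/
noncomputable def nextEnd {n : ℕ} (S : Finset (Fin n)) (l : Fin n) : ℕ :=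
  sInf {m : ℕ | (l : ℕ) < m ∧ (m = n ∨ ∃ i ∈ S, (i : ℕ) = m)}

theorem nextEnd_mem {n : ℕ} (S : Finset (Fin n)) (l : Fin n) :
    (l : ℕ) < nextEnd S l ∧ (nextEnd S l = n ∨ ∃ i ∈ S, (i : ℕ) = nextEnd S l) :=
  Nat.sInf_mem (s := {m : ℕ | (l : ℕ) < m ∧ (m = n ∨ ∃ i ∈ S, (i : ℕ) = m)})
    ⟨n, l.2, Or.inl rfl⟩

theorem lt_nextEnd {n : ℕ} (S : Finset (Fin n)) (l : Fin n) : (l : ℕ) < nextEnd S l :=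
  (nextEnd_mem S l).1

theorem nextEnd_le {n : ℕ} (S : Finset (Fin n)) (l : Fin n) : nextEnd S l ≤ n :=
  Nat.sInf_le ⟨l.2, Or.inl rfl⟩

theorem nextEnd_le_of_mem {n : ℕ} {S : Finset (Fin n)} {l i : Fin n} (hi : i ∈ S) (hl : l < i) :
    nextEnd S l ≤ i :=
  Nat.sInf_le ⟨hl, Or.inr ⟨i, hi, rfl⟩⟩

/-- The cyclic label of a column: `n` for the column `0`, and `l` for the column `l ≠ 0`. -/
def cyclicLabel (m : ℕ) (l : Fin (m + 1)) : ℕ := if l = 0 then m + 1 else l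

/-- `nextEnd` is the cyclic successor in `S`: after the largest element one returns to `0`, whose
cyclic label is `m + 1`. -/
theorem nextEnd_orderIsoOfFin {m k : ℕ} (S : Finset (Fin (m + 1))) (h0 : 0 ∈ S)
    (hk : S.card = k + 1) (a : Fin (k + 1)) :
    nextEnd S (S.orderIsoOfFin hk a) =
      cyclicLabel m (S.orderIsoOfFin hk (finRotate (k + 1) a)) := by
  set e := S.orderIsoOfFin hk with he
  rcases Fin.eq_castSucc_or_eq_last a with ⟨b, rfl⟩ | rfl
  · have hlt : (e b.castSucc : Fin (m + 1)) < e b.succ :=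
      (e.lt_iff_lt.2 Fin.castSucc_lt_succ : e b.castSucc < e b.succ)
    have hne : (e b.succ : Fin (m + 1)) ≠ 0 := (lt_of_le_of_lt (Fin.zero_le _) hlt).ne'
    rw [show finRotate (k + 1) b.castSucc = b.succ by
      rw [finRotate_apply, Fin.coeSucc_eq_succ], cyclicLabel, if_neg hne]
    refine le_antisymm (nextEnd_le_of_mem (e b.succ).2 hlt) ?_
    obtain ⟨h1, h2 | ⟨i, hi, h2⟩⟩ := nextEnd_mem S (e b.castSucc)
    · rw [h2]; exact (e b.succ : Fin (m + 1)).2.le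
    · rw [← h2] at h1 ⊢
      have h3 : e b.castSucc < ⟨i, hi⟩ := h1
      have h4 : b.castSucc < e.symm ⟨i, hi⟩ := by rwa [← e.lt_iff_lt, e.apply_symm_apply]
      have h5 : b.succ ≤ e.symm ⟨i, hi⟩ := Fin.castSucc_lt_iff_succ_le.1 h4
      rw [← e.le_iff_le, e.apply_symm_apply] at h5
      exact h5
  · have hz : (e 0 : Fin (m + 1)) = 0 := by
      have h1 : (0 : Fin (k + 1)) ≤ e.symm ⟨0, h0⟩ := Fin.zero_le _
      rw [← e.le_iff_le, e.apply_symm_apply] at h1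
      exact le_antisymm h1 (Fin.zero_le _)
    rw [finRotate_last, hz, cyclicLabel, if_pos rfl]
    obtain ⟨h1, h2 | ⟨i, hi, h2⟩⟩ := nextEnd_mem S (e (Fin.last k))
    · exact h2
    · rw [← h2] at h1
      have h3 : e (Fin.last k) < ⟨i, hi⟩ := h1
      rw [← e.apply_symm_apply ⟨i, hi⟩, e.lt_iff_lt] at h3
      exact absurd h3 (not_lt.2 (Fin.le_last _))

theorem det_cyclicLabel {m : ℕ} (f : ℕ → ℕ → R) (S : Finset (Fin (m + 1))) (h0 : 0 ∈ S) :
    (Matrix.of fun l i : S => f (cyclicLabel m l) (i : Fin (m + 1))).det =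
      (-1) ^ (S.card - 1) *
        (Matrix.of fun l i : S => f (nextEnd S l) (i : Fin (m + 1))).det := by
  obtain ⟨k, hk⟩ : ∃ k, S.card = k + 1 :=
    ⟨S.card - 1, by have := Finset.card_pos.2 ⟨_, h0⟩; omega⟩
  set e := S.orderIsoOfFin hk with he
  have h1 : ((Matrix.of fun l i : S => f (nextEnd S l) (i : Fin (m + 1))).submatrix e e) =
      ((Matrix.of fun l i : S => f (cyclicLabel m l) (i : Fin (m + 1))).submatrix e e).submatrix
        (finRotate (k + 1)) id := by
    ext a b
    simp only [Matrix.submatrix_apply, Matrix.of_apply, id]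
    rw [nextEnd_orderIsoOfFin S h0 hk]
  have h2 := Matrix.det_submatrix_equiv_self e.toEquiv
    (Matrix.of fun l i : S => f (cyclicLabel m l) (i : Fin (m + 1)))
  have h3 := Matrix.det_submatrix_equiv_self e.toEquiv
    (Matrix.of fun l i : S => f (nextEnd S l) (i : Fin (m + 1)))
  rw [← h2, ← h3]
  change _ = _ * ((Matrix.of fun l i : S => f (nextEnd S l) (i : Fin (m + 1))).submatrix
    e e).det
  rw [h1, Matrix.det_permute, sign_finRotate, hk, ← mul_assoc]
  simp only [Nat.add_sub_cancel]
  push_cast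
  rw [← mul_pow]
  simp

/-- Rotating the columns moves the subtracted entries onto the diagonal, giving `B + D` after
transposition. Choosing the rows in `S` from `B` and the others from `D` leaves a principal minor of
`B`, whose rows are then rotated within `S`. -/
theorem det_sub_shift (m : ℕ) (f : ℕ → ℕ → R) :
    (Matrix.of fun i j : Fin (m + 1) => f (j + 1) i - if (i : ℕ) = j + 1 then 1 else 0).det =
      ∑ S : Finset (Fin (m + 1)), if 0 ∈ S then
        (Matrix.of fun l i : S => f (nextEnd S l) (i : Fin (m + 1))).det else 0 := by
  let B : Matrix (Fin (m + 1)) (Fin (m + 1)) R :=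
    Matrix.of fun l i => f (cyclicLabel m l) i
  -- Row `0` of `D` vanishes because the subtracted entry of the last column would lie in row `m +
  -- 1`. Hence only sets containing `0` contribute.
  let D : Matrix (Fin (m + 1)) (Fin (m + 1)) R :=
    Matrix.of fun l i => if i = l ∧ l ≠ 0 then -1 else 0
  have h1 : (Matrix.of fun i j : Fin (m + 1) =>
      f (j + 1) i - if (i : ℕ) = j + 1 then 1 else 0) =
      (B + D).transpose.submatrix id (finRotate (m + 1)) := by
    ext i j
    simp only [Matrix.submatrix_apply, Matrix.transpose_apply, Matrix.add_apply, B, D,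
      Matrix.of_apply, id]
    rcases Fin.eq_castSucc_or_eq_last j with ⟨b, rfl⟩ | rfl
    · rw [show finRotate (m + 1) b.castSucc = b.succ by
        rw [finRotate_apply, Fin.coeSucc_eq_succ]]
      rw [cyclicLabel, if_neg (Fin.succ_ne_zero b), sub_eq_add_neg]
      simp only [Fin.val_succ, Fin.val_castSucc, Fin.ext_iff]
      congr 1
      split_ifs <;> simp_all
    · rw [finRotate_last, cyclicLabel, if_pos rfl, if_neg (by simp; omega), if_neg (by simp)]
      simp
  rw [h1, Matrix.det_permute', Matrix.det_transpose, sign_finRotate]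
  let P (S : Finset (Fin (m + 1))) : Matrix (Fin (m + 1)) (Fin (m + 1)) R :=
    Matrix.of fun l i => if l ∈ S then B l i else D l i
  have h2 : (B + D).det = ∑ S : Finset (Fin (m + 1)), (P S).det := by
    refine ((Matrix.detRowAlternating (R := R) (n := Fin (m + 1))).toMultilinearMap.map_add_univ
      B D).trans (Finset.sum_congr rfl fun S _ => ?_)
    refine congrArg Matrix.det (funext fun l => funext fun i => ?_)
    by_cases h : l ∈ S
    · simp [P, Finset.piecewise, h]
    · simp [P, Finset.piecewise, h]
  rw [h2, Finset.mul_sum]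
  refine Finset.sum_congr rfl fun S _ => ?_
  split_ifs with h0
  · have h3 : ((P S).toSquareBlockProp (fun i => i ∈ S)).det =
        (Matrix.of fun l i : S => f (cyclicLabel m l) (i : Fin (m + 1))).det := by
      have : (P S).toSquareBlockProp (fun i => i ∈ S) =
          Matrix.of fun l i : S => f (cyclicLabel m l) (i : Fin (m + 1)) := by
        ext l i
        simp [Matrix.toSquareBlockProp, Matrix.toBlock, P, B]
      rw [this]
    have hb : (P S).det = (Matrix.of fun l i : S => f (cyclicLabel m l) (i : Fin (m + 1))).det *
        ((P S).toSquareBlockProp (fun i => ¬ i ∈ S)).det := by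
      rw [Matrix.twoBlockTriangular_det _ (fun i => i ∈ S)]
      · congr 1
        convert h3
      · intro i hi j hj
        simp only [Matrix.of_apply, if_neg hi, P, D]
        rw [if_neg]
        rintro ⟨rfl, -⟩
        exact hi hj
    have h4 : (P S).toSquareBlockProp (fun i => ¬ i ∈ S) =
        -(1 : Matrix {i // ¬ i ∈ S} {i // ¬ i ∈ S} R) := by
      ext l i
      have hl : (l : Fin (m + 1)) ≠ 0 := fun h => l.2 (h ▸ h0)
      simp only [Matrix.toSquareBlockProp, Matrix.toBlock, Matrix.of_apply,
        Matrix.submatrix_apply, if_neg l.2, P, D, Matrix.neg_apply, Matrix.one_apply]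
      by_cases h : l = i
      · subst h
        simp [hl]
      · rw [if_neg (fun h' => h (Subtype.ext h'.1.symm)), if_neg h, neg_zero]
    have hcard : Fintype.card {i // ¬ i ∈ S} = m + 1 - S.card := by
      rw [Fintype.card_subtype_compl, Fintype.card_coe, Fintype.card_fin]
    have hS1 : 1 ≤ S.card := Finset.card_pos.2 ⟨_, h0⟩
    have hS2 : S.card ≤ m + 1 := by simpa using Finset.card_le_univ S
    rw [hb, h4, det_cyclicLabel f S h0, Matrix.det_neg, Matrix.det_one, hcard, mul_one,
      mul_right_comm ((-1 : R) ^ (S.card - 1)), ← pow_add, ← mul_assoc]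
    push_cast
    -- The signs come from the rotation of all columns, the rotation within `S`, and the diagonal
    -- `-1`s outside `S`: `m + (|S| - 1) + (m + 1 - |S|) = 2 m`.
    rw [← pow_add, Even.neg_one_pow ⟨m, by omega⟩, one_mul]
  · rw [Matrix.det_eq_zero_of_row_eq_zero (0 : Fin (m + 1)), mul_zero]
    intro j
    simp [P, h0, D]

end Expansion

/-! ### Nonintersecting paths, one column at a time. -/

section NonintersectingPaths

variable {R : Type*} [CommRing R] {n : ℕ}

/-- The values that the next column of a system of nonintersecting paths may take in row `i`,
after the column `h`: the rows are labelled by their lengths `i ∈ S`, the next column has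
position `p`, and consists of the rows of length greater than `p`. -/
def interlaceBox (S : Finset (Fin n)) (p : ℕ) (h : Fin n → ℕ) (i : Fin n) : Finset ℕ :=
  if i ∈ S ∧ p < i then
    Finset.Ioc ((S.filter fun k : Fin n => p ≤ (k : ℕ) ∧ k < i).sup h) (h i)
  else {0}

/-- The weight of the column in position `p`. -/
def columnWeight (x y z : R) (S : Finset (Fin n)) (p : ℕ) (h : Fin n → ℕ) : R :=
  ∏ i : Fin n, if i ∈ S ∧ p < i then partWeight n x y z p (h i) else 1

/-- The matrix of path weights from position `p` and heights `h` to the ends in `S`, padded with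
rows and columns of the identity matrix. -/
noncomputable def pathMatrix (x y z : R) (S : Finset (Fin n)) (p : ℕ) (h : Fin n → ℕ) :
    Matrix (Fin n) (Fin n) R :=
  Matrix.of fun i j =>
    if (i ∈ S ∧ p ≤ i) ∧ (j ∈ S ∧ p ≤ j) then pathWeight n x y z p (h i) j
    else if i = j then 1 else 0

/-- The heights increase strictly with the row lengths, and are at most `n`. -/
def Admissible (S : Finset (Fin n)) (p : ℕ) (h : Fin n → ℕ) : Prop :=
  (∀ i ∈ S, p ≤ (i : ℕ) → h i ≤ n) ∧
    ∀ i ∈ S, ∀ j ∈ S, p ≤ (i : ℕ) → i < j → h i < h j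

/-- For `e > p`, the paths lost on lowering the bound from `h` to `l` are those whose part `v` in
position `p` satisfies `l < v ≤ h`. The recursion telescopes over these `v`. -/
theorem pathWeight_sub (x y z : R) (p e l h : ℕ) (hp : p < n) (hlh : l ≤ h)
    (hh : h ≤ n) :
    pathWeight n x y z p h e - pathWeight n x y z p l e =
      ∑ v ∈ Finset.Ioc l h, partWeight n x y z p v * pathWeight n x y z (p + 1) v e := by
  induction h, hlh using Nat.le_induction with
  | base => simp
  | succ h hlh ih =>
    rw [← Finset.insert_Ioc_right_eq_Ioc_add_one hlh, Finset.sum_insert (by simp),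
      ← ih (by omega), pathWeight_succ n x y z p h e hp (by omega)]
    ring

theorem Admissible.step {S : Finset (Fin n)} {p : ℕ} {h h' : Fin n → ℕ} (hh : Admissible S p h)
    (hh' : ∀ i, h' i ∈ interlaceBox S p h i) : Admissible S (p + 1) h' := by
  have key : ∀ i ∈ S, p + 1 ≤ (i : ℕ) →
      h' i ∈ Finset.Ioc ((S.filter fun k : Fin n => p ≤ (k : ℕ) ∧ k < i).sup h) (h i) := by
    intro i hi hpi
    have := hh' i
    rwa [interlaceBox, if_pos ⟨hi, hpi⟩] at this
  refine ⟨fun i hi hpi => ?_, fun i hi j hj hpi hij => ?_⟩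
  · exact (Finset.mem_Ioc.1 (key i hi hpi)).2.trans (hh.1 i hi (by omega))
  · have h1 := (Finset.mem_Ioc.1 (key i hi hpi)).2
    have h2 := (Finset.mem_Ioc.1 (key j hj (by omega))).1
    have h3 : h i ≤ (S.filter fun k : Fin n => p ≤ (k : ℕ) ∧ k < j).sup h :=
      Finset.le_sup (by simp only [Finset.mem_filter]; exact ⟨hi, by omega, hij⟩)
    omega

/-- The matrix obtained from `pathMatrix` by subtracting from each row the preceding one. -/
noncomputable def pathDiffMatrix (x y z : R) (S : Finset (Fin n)) (p : ℕ) (h : Fin n → ℕ) :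
    Matrix (Fin n) (Fin n) R :=
  Matrix.of fun i j =>
    if (i ∈ S ∧ p < i) ∧ (j ∈ S ∧ p < j) then
      ∑ v ∈ interlaceBox S p h i, partWeight n x y z p v * pathWeight n x y z (p + 1) v j
    else if i = j then 1 else 0

/-- Subtracting the preceding row confines each new part strictly above the preceding height. This
already enforces nonintersection, so no cancellation of crossing paths is needed. -/
theorem det_pathMatrix_eq_det_pathDiffMatrix (x y z : R) (S : Finset (Fin n)) (p : ℕ)
    (h : Fin n → ℕ) (hp : p < n) (hh : Admissible S p h) :
    (pathMatrix x y z S p h).det = (pathDiffMatrix x y z S p h).det := by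
  let IsPred (i k : Fin n) : Prop :=
    (i ∈ S ∧ p ≤ i) ∧ (k ∈ S ∧ p ≤ k) ∧ k < i ∧ ∀ l ∈ S, p ≤ (l : ℕ) → l < i → l ≤ k
  classical
  let P : Matrix (Fin n) (Fin n) R := Matrix.of fun i k => if IsPred i k then 1 else 0
  -- A path ending at `p` has no predecessor, so its row survives the subtraction; `V` holds the
  -- entries to the right of its diagonal `1`, which column operations remove.
  let V : Matrix (Fin n) (Fin n) R := Matrix.of fun k j =>
    if (k : ℕ) = p ∧ k ∈ S ∧ j ∈ S ∧ k < j then pathWeight n x y z p (h k) j else 0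
  have hU : (1 - P).det = 1 := by
    rw [Matrix.det_of_isLowerTriangular]
    · refine Finset.prod_eq_one fun i _ => ?_
      have : ¬ IsPred i i := fun hi => lt_irrefl _ hi.2.2.1
      simp [P, this]
    · intro i k hik
      have hik : i < k := hik
      have h1 : ¬ IsPred i k := fun hi => lt_asymm hik hi.2.2.1
      simp [P, h1, Matrix.one_apply_ne hik.ne]
  have hW : (1 + V).det = 1 := by
    rw [Matrix.det_of_isUpperTriangular]
    · refine Finset.prod_eq_one fun i _ => ?_
      simp [V]
    · intro i k hik
      have hik : k < i := hik
      simp [V, hik.not_gt, Matrix.one_apply_ne hik.ne']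
  have hPM : ∀ i j, (P * pathMatrix x y z S p h) i j =
      ∑ k, if IsPred i k then pathMatrix x y z S p h k j else 0 := by
    intro i j
    rw [Matrix.mul_apply]
    simp [P]
  have hPM1 : ∀ i k j, IsPred i k → (P * pathMatrix x y z S p h) i j =
      pathMatrix x y z S p h k j := by
    intro i k j hik
    rw [hPM, Finset.sum_eq_single k, if_pos hik]
    · intro l _ hl
      rw [if_neg]
      intro hil
      exact hl (le_antisymm (hik.2.2.2 l hil.2.1.1 hil.2.1.2 hil.2.2.1)
        (hil.2.2.2 k hik.2.1.1 hik.2.1.2 hik.2.2.1))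
    · simp
  have hPM0 : ∀ i j, (∀ k, ¬ IsPred i k) → (P * pathMatrix x y z S p h) i j = 0 := by
    intro i j hi
    rw [hPM]
    exact Finset.sum_eq_zero fun k _ => if_neg (hi k)
  have hpred : ∀ i ∈ S, p ≤ (i : ℕ) →
      (∃ k, IsPred i k ∧ (S.filter fun k : Fin n => p ≤ (k : ℕ) ∧ k < i).sup h = h k) ∨
      ((∀ k, ¬ IsPred i k) ∧ ∀ k ∈ S, p ≤ (k : ℕ) → ¬ k < i) := by
    intro i hi hpi
    rcases (S.filter fun k : Fin n => p ≤ (k : ℕ) ∧ k < i).eq_empty_or_nonempty with he | hne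
    · right
      have h1 : ∀ k ∈ S, p ≤ (k : ℕ) → ¬ k < i := fun k hk hpk hki => by
        have : k ∈ S.filter fun k : Fin n => p ≤ (k : ℕ) ∧ k < i := Finset.mem_filter.2 ⟨hk, hpk, hki⟩
        rw [he] at this
        simp at this
      exact ⟨fun k hk => h1 k hk.2.1.1 hk.2.1.2 hk.2.2.1, h1⟩
    · left
      obtain ⟨k, hk, hmax⟩ := Finset.exists_max_image _ (fun k : Fin n => k) hne
      obtain ⟨hkS, hpk, hki⟩ := Finset.mem_filter.1 hk
      have hmax' : ∀ l ∈ S, p ≤ (l : ℕ) → l < i → l ≤ k := fun l hl hpl hli =>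
        hmax l (Finset.mem_filter.2 ⟨hl, hpl, hli⟩)
      refine ⟨k, ⟨⟨hi, hpi⟩, ⟨hkS, hpk⟩, hki, hmax'⟩, le_antisymm ?_ (Finset.le_sup hk)⟩
      refine Finset.sup_le fun l hl => ?_
      obtain ⟨hlS, hpl, hli⟩ := Finset.mem_filter.1 hl
      rcases (hmax' l hlS hpl hli).eq_or_lt with rfl | hlt
      · exact le_rfl
      · exact (hh.2 l hlS k hkS hpl hlt).le
  have hMV : ∀ i j, (pathDiffMatrix x y z S p h * V) i j = V i j := by
    intro i j
    rw [Matrix.mul_apply, Finset.sum_eq_single i]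
    · by_cases hi : (i : ℕ) = p ∧ i ∈ S ∧ j ∈ S ∧ i < j
      · rw [pathDiffMatrix, Matrix.of_apply, if_neg (by omega), if_pos rfl, one_mul]
      · simp [V, hi]
    · intro k _ hk
      by_cases hi : (k : ℕ) = p ∧ k ∈ S ∧ j ∈ S ∧ k < j
      · rw [pathDiffMatrix, Matrix.of_apply, if_neg (by omega), if_neg hk.symm, zero_mul]
      · simp [V, hi]
    · simp
  have hmain : (1 - P) * pathMatrix x y z S p h = pathDiffMatrix x y z S p h * (1 + V) := by
    ext i j
    rw [sub_mul, mul_add, one_mul, mul_one, Matrix.sub_apply, Matrix.add_apply, hMV]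
    by_cases hi : i ∈ S ∧ p ≤ (i : ℕ)
    swap
    · rw [hPM0 i j fun k hk => hi hk.1]
      simp only [pathMatrix, pathDiffMatrix, V, Matrix.of_apply]
      rw [if_neg (show ¬((i ∈ S ∧ p ≤ (i : ℕ)) ∧ j ∈ S ∧ p ≤ (j : ℕ)) from fun hc => hi hc.1),
        if_neg (show ¬((i ∈ S ∧ p < (i : ℕ)) ∧ j ∈ S ∧ p < (j : ℕ)) from
          fun hc => hi ⟨hc.1.1, hc.1.2.le⟩),
        if_neg (show ¬((i : ℕ) = p ∧ i ∈ S ∧ j ∈ S ∧ i < j) from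
          fun hc => hi ⟨hc.2.1, hc.1.ge⟩), sub_zero, add_zero]
    by_cases hj : j ∈ S ∧ p ≤ (j : ℕ)
    swap
    · have hij : i ≠ j := fun hij => hj (hij ▸ hi)
      have h0 : (P * pathMatrix x y z S p h) i j = 0 := by
        by_cases hk : ∃ k, IsPred i k
        · obtain ⟨k, hk⟩ := hk
          have hkj : k ≠ j := fun hkj => hj (hkj ▸ hk.2.1)
          rw [hPM1 i k j hk, pathMatrix, Matrix.of_apply, if_neg fun hc => hj hc.2, if_neg hkj]
        · exact hPM0 i j (not_exists.1 hk)
      rw [h0]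
      simp only [pathMatrix, pathDiffMatrix, V, Matrix.of_apply]
      rw [if_neg fun hc => hj hc.2, if_neg hij, if_neg fun hc => hj ⟨hc.2.1, hc.2.2.le⟩,
        if_neg fun hc => hj ⟨hc.2.2.1, by have := hc.2.2.2; omega⟩, sub_zero, add_zero]
    have hMij : pathMatrix x y z S p h i j = pathWeight n x y z p (h i) j := by
      rw [pathMatrix, Matrix.of_apply, if_pos ⟨hi, hj⟩]
    rcases hi.2.eq_or_lt with hpi | hpi
    · have h0 : (P * pathMatrix x y z S p h) i j = 0 := by
        refine hPM0 i j fun k hk => ?_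
        have h1 := hk.2.1.2
        have h2 : (k : ℕ) < i := hk.2.2.1
        omega
      rw [h0, sub_zero, hMij]
      simp only [pathDiffMatrix, V, Matrix.of_apply]
      rw [if_neg (by omega)]
      rcases hj.2.eq_or_lt with hpj | hpj
      · have hij : i = j := Fin.ext (hpi.symm.trans hpj)
        subst hij
        rw [if_pos rfl, if_neg (by simp), add_zero, ← hpi, pathWeight_self n x y z p _ hp]
      · have hij : i < j := Fin.lt_def.2 (by omega)
        rw [if_neg hij.ne, if_pos ⟨hpi.symm, hi.1, hj.1, hij⟩, zero_add]
    · have hV : V i j = 0 := if_neg (by omega)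
      rw [hV, add_zero]
      rcases hj.2.eq_or_lt with hpj | hpj
      -- Column `p` counts empty paths, so its entries are all `1` and the difference is `0`.
      · have hji : j < i := Fin.lt_def.2 (by omega)
        rcases hpred i hi.1 hi.2 with ⟨k, hk, -⟩ | ⟨-, hk⟩
        · rw [hMij, hPM1 i k j hk, pathMatrix, Matrix.of_apply, if_pos ⟨hk.2.1, hj⟩,
            pathDiffMatrix, Matrix.of_apply, if_neg (by omega), if_neg hji.ne', ← hpj,
            pathWeight_self n x y z p _ hp, pathWeight_self n x y z p _ hp, sub_self]
        · exact absurd hji (hk j hj.1 hj.2)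
      · rw [pathDiffMatrix, Matrix.of_apply, if_pos ⟨⟨hi.1, hpi⟩, hj.1, hpj⟩, interlaceBox,
          if_pos ⟨hi.1, hpi⟩, hMij]
        rcases hpred i hi.1 hi.2 with ⟨k, hk, hsup⟩ | ⟨hk, hk'⟩
        · rw [hPM1 i k j hk, pathMatrix, Matrix.of_apply, if_pos ⟨hk.2.1, hj⟩, hsup]
          exact pathWeight_sub x y z p j _ _ hp
            (hh.2 k hk.2.1.1 i hi.1 hk.2.1.2 hk.2.2.1).le (hh.1 i hi.1 hi.2)
        -- A lowest row with `p < i` is compared with height `0`, from which no path reaches `j >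
        -- p`.
        · have hsup : (S.filter fun k : Fin n => p ≤ (k : ℕ) ∧ k < i).sup h = 0 := by
            rw [Finset.filter_false_of_mem fun k hkS hc => hk' k hkS hc.1 hc.2]
            simp
          rw [hPM0 i j hk, hsup, ← pathWeight_zero n x y z p j (by omega) hpj]
          exact pathWeight_sub x y z p j _ _ hp (Nat.zero_le _) (hh.1 i hi.1 hi.2)
  have hdet := congrArg Matrix.det hmain
  rwa [Matrix.det_mul, Matrix.det_mul, hU, hW, one_mul, mul_one] at hdet

/-- Each row is a sum over its next part. Multilinearity therefore sums over whole columns `h'`, and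
the part weights factor out of the rows. -/
theorem det_pathDiffMatrix (x y z : R) (S : Finset (Fin n)) (p : ℕ) (h : Fin n → ℕ) :
    (pathDiffMatrix x y z S p h).det =
      ∑ h' ∈ Fintype.piFinset (interlaceBox S p h),
        columnWeight x y z S p h' * (pathMatrix x y z S (p + 1) h').det := by
  let g : (i : Fin n) → ℕ → (Fin n → R) := fun i v j =>
    (if i ∈ S ∧ p < i then partWeight n x y z p v else 1) *
      if (i ∈ S ∧ p < i) ∧ (j ∈ S ∧ p < j) then pathWeight n x y z (p + 1) v j
      else if i = j then 1 else 0
  have h1 : pathDiffMatrix x y z S p h =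
      Matrix.of fun i => ∑ v ∈ interlaceBox S p h i, g i v := by
    ext i j
    rw [Matrix.of_apply, Finset.sum_apply, pathDiffMatrix, Matrix.of_apply]
    by_cases hi : i ∈ S ∧ p < (i : ℕ)
    · by_cases hj : j ∈ S ∧ p < (j : ℕ)
      · simp only [g, if_pos hi, if_pos (And.intro hi hj)]
      · have hij : i ≠ j := fun hij => hj (hij ▸ hi)
        simp only [g, if_neg fun hc : (i ∈ S ∧ p < (i : ℕ)) ∧ (j ∈ S ∧ p < (j : ℕ)) => hj hc.2,
          if_neg hij, mul_zero, Finset.sum_const_zero]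
    · simp only [g, interlaceBox, if_neg hi, Finset.sum_singleton,
        if_neg fun hc : (i ∈ S ∧ p < (i : ℕ)) ∧ (j ∈ S ∧ p < (j : ℕ)) => hi hc.1, one_mul]
  rw [h1]
  refine ((Matrix.detRowAlternating (R := R) (n := Fin n)).toMultilinearMap.map_sum_finset g
    (interlaceBox S p h)).trans (Finset.sum_congr rfl fun h' _ => ?_)
  exact Matrix.det_mul_column
    (fun i => if i ∈ S ∧ p < (i : ℕ) then partWeight n x y z p (h' i) else 1)
    (pathMatrix x y z S (p + 1) h')

/-- Add a first column. -/
def consColumn (h : Fin n → ℕ) (b : ℕ → Fin n → ℕ) : ℕ → Fin n → ℕ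
  | 0 => h
  | q + 1 => b q

theorem consColumn_injective :
    Function.Injective fun c : Σ _ : Fin n → ℕ, ℕ → Fin n → ℕ => consColumn c.1 c.2 := by
  rintro ⟨h, b⟩ ⟨h', b'⟩ heq
  have h0 : h = h' := congrFun heq 0
  have h1 : b = b' := funext fun q => congrFun heq (q + 1)
  rw [h0, h1]

/-- The systems of nonintersecting paths with `m` columns, from position `p` and heights `h`. -/
def pathSystems (S : Finset (Fin n)) : ℕ → ℕ → (Fin n → ℕ) → Finset (ℕ → Fin n → ℕ)
  | 0, _, _ => {fun _ _ => 0}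
  | m + 1, p, h =>
    ((Fintype.piFinset (interlaceBox S p h)).sigma fun h' => pathSystems S m (p + 1) h').map
      ⟨fun c => consColumn c.1 c.2, consColumn_injective⟩

theorem det_pathMatrix (x y z : R) (S : Finset (Fin n)) (m p : ℕ) (h : Fin n → ℕ)
    (hm : p + m = n) (hh : Admissible S p h) :
    (pathMatrix x y z S p h).det =
      ∑ b ∈ pathSystems S m p h, ∏ q ∈ Finset.range m, columnWeight x y z S (p + q) (b q) := by
  induction m generalizing p h with
  | zero =>
    have h1 : pathMatrix x y z S p h = 1 := by
      ext i j
      rw [pathMatrix, Matrix.of_apply, if_neg (by omega), Matrix.one_apply]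
    rw [h1]
    simp [pathSystems]
  | succ m ih =>
    rw [det_pathMatrix_eq_det_pathDiffMatrix x y z S p h (by omega) hh, det_pathDiffMatrix,
      pathSystems, Finset.sum_map, Finset.sum_sigma]
    refine Finset.sum_congr rfl fun h' hh' => ?_
    rw [ih (p + 1) h' (by omega) (hh.step (Fintype.mem_piFinset.1 hh')), Finset.mul_sum]
    refine Finset.sum_congr rfl fun b _ => ?_
    rw [Finset.prod_range_succ', mul_comm]
    refine congrArg₂ _ (Finset.prod_congr rfl fun q _ => ?_) rfl
    rw [show p + 1 + q = p + (q + 1) by omega]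
    rfl

theorem mem_pathSystems (S : Finset (Fin n)) (m p : ℕ) (h : Fin n → ℕ) (b : ℕ → Fin n → ℕ) :
    b ∈ pathSystems S m p h ↔
      (∀ q < m, ∀ i, b q i ∈ interlaceBox S (p + q) (consColumn h b q) i) ∧
        ∀ q, m ≤ q → ∀ i, b q i = 0 := by
  induction m generalizing p h b with
  | zero =>
    simp only [pathSystems, Finset.mem_singleton]
    constructor
    · rintro rfl
      simp
    · rintro ⟨-, h2⟩
      exact funext fun q => funext fun i => h2 q (Nat.zero_le _) i
  | succ m ih =>
    simp only [pathSystems, Finset.mem_map, Finset.mem_sigma, Function.Embedding.coeFn_mk,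
      Fintype.mem_piFinset]
    have hprec : ∀ (h' : Fin n → ℕ) (b' : ℕ → Fin n → ℕ) (q : ℕ),
        consColumn h' b' q = consColumn h (consColumn h' b') (q + 1) := by
      intro h' b' q
      cases q <;> rfl
    constructor
    · rintro ⟨⟨h', b'⟩, ⟨h1, h2⟩, rfl⟩
      rw [ih] at h2
      refine ⟨fun q hq => ?_, fun q hq => ?_⟩
      · cases q with
        | zero => exact h1
        | succ q =>
          intro i
          have := h2.1 q (by omega) i
          rw [show p + 1 + q = p + (q + 1) by omega] at this
          rw [← hprec]
          exact this
      · obtain ⟨q, rfl⟩ : ∃ q', q = q' + 1 := ⟨q - 1, by omega⟩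
        exact h2.2 q (by omega)
    · rintro ⟨h1, h2⟩
      have hb : consColumn (b 0) (fun q => b (q + 1)) = b := by
        funext q
        cases q <;> rfl
      refine ⟨⟨b 0, fun q => b (q + 1)⟩, ⟨h1 0 (by omega), (ih _ _ _).2 ⟨fun q hq i => ?_,
        fun q hq => h2 _ (by omega)⟩⟩, hb⟩
      rw [hprec, hb, show p + 1 + q = p + (q + 1) by omega]
      exact h1 (q + 1) (by omega) i

theorem admissible_nextEnd (S : Finset (Fin n)) : Admissible S 0 (nextEnd S) :=
  ⟨fun _ _ _ => nextEnd_le S _, fun _ _ j hj _ hij =>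
    (nextEnd_le_of_mem hj hij).trans_lt (lt_nextEnd S j)⟩

theorem det_nextEnd (x y z : R) (S : Finset (Fin n)) :
    (Matrix.of fun l i : S => pathWeight n x y z 0 (nextEnd S l) (i : Fin n)).det =
      ∑ b ∈ pathSystems S n 0 (nextEnd S),
        ∏ q ∈ Finset.range n, columnWeight x y z S q (b q) := by
  have h1 := det_pathMatrix x y z S n 0 (nextEnd S) (Nat.zero_add n) (admissible_nextEnd S)
  simp only [Nat.zero_add] at h1
  rw [← h1, Matrix.twoBlockTriangular_det _ (fun i => i ∈ S)]
  · have h2 : (pathMatrix x y z S 0 (nextEnd S)).toSquareBlockProp (fun i => ¬ i ∈ S) = 1 := by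
      ext i j
      rw [Matrix.toSquareBlockProp, Matrix.toBlock, Matrix.submatrix_apply, pathMatrix,
        Matrix.of_apply, if_neg fun hc => i.2 hc.1.1, Matrix.one_apply]
      simp only [Subtype.ext_iff]
    have h3 : (pathMatrix x y z S 0 (nextEnd S)).toSquareBlockProp (fun i => i ∈ S) =
        Matrix.of fun l i : S => pathWeight n x y z 0 (nextEnd S l) (i : Fin n) := by
      ext i j
      simp [Matrix.toSquareBlockProp, Matrix.toBlock, pathMatrix]
    rw [h2, Matrix.det_one, mul_one, h3]
    congr!
  · intro i hi j hj
    rw [pathMatrix, Matrix.of_apply, if_neg fun hc => hi hc.1.1, if_neg]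
    rintro rfl
    exact hi hj

end NonintersectingPaths

/-! ### Path systems as arrays with rows labelled by length. -/

section Arrays

variable {n : ℕ}

/-- The conditions on a descending plane partition whose rows are labelled by their lengths
`i ∈ S \ {0}`, with `b q i` the part in position `q` of the row labelled `i`. -/
structure IsPathArray (S : Finset (Fin n)) (b : ℕ → Fin n → ℕ) : Prop where
  eq_zero : ∀ q i, ¬ (i ∈ S ∧ q < (i : ℕ)) → b q i = 0
  pos : ∀ q i, i ∈ S → q < (i : ℕ) → 0 < b q i
  lt_head : ∀ i ∈ S, 0 < (i : ℕ) → i < b 0 i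
  head_le : ∀ i ∈ S, 0 < (i : ℕ) → b 0 i ≤ nextEnd S i
  row_le : ∀ q, ∀ i ∈ S, q + 1 < (i : ℕ) → b (q + 1) i ≤ b q i
  col_lt : ∀ q, ∀ i ∈ S, ∀ j ∈ S, q < (i : ℕ) → i < j → b q i < b (q + 1) j

/-- The supremum is attained at the predecessor of `i` in `S`, which exists because `0` belongs to
`S`. This is where the strict bound of a row's first part by its own length comes from. -/
theorem sup_nextEnd {S : Finset (Fin n)} (h0 : ∃ i ∈ S, (i : ℕ) = 0) {i : Fin n} (hi : i ∈ S)
    (hpos : 0 < (i : ℕ)) :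
    (S.filter fun k : Fin n => 0 ≤ (k : ℕ) ∧ k < i).sup (nextEnd S) = i := by
  refine le_antisymm (Finset.sup_le fun k hk => nextEnd_le_of_mem hi (Finset.mem_filter.1 hk).2.2)
    ?_
  obtain ⟨o, ho, ho0⟩ := h0
  have hne : (S.filter fun k : Fin n => 0 ≤ (k : ℕ) ∧ k < i).Nonempty :=
    ⟨o, Finset.mem_filter.2 ⟨ho, Nat.zero_le _, Fin.lt_def.2 (by omega)⟩⟩
  obtain ⟨k, hk, hmax⟩ := Finset.exists_max_image _ (fun k : Fin n => k) hne
  refine le_trans ?_ (Finset.le_sup hk)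
  obtain ⟨h1, h2 | ⟨l, hl, h2⟩⟩ := nextEnd_mem S k
  · rw [h2]
    exact i.2.le
  · by_contra hlt
    have hli : l < i := Fin.lt_def.2 (by omega)
    have h3 : l ≤ k := hmax l (Finset.mem_filter.2 ⟨hl, Nat.zero_le _, hli⟩)
    have h4 : (l : ℕ) ≤ k := h3
    omega

/-- In position `0` the box is the interval from the length (excluded) to `nextEnd`. In later
positions its upper end is row monotonicity and its lower end column strictness. A row of length
exactly `p` still bounds position `p`, through its last part in position `p - 1`. -/
theorem mem_pathSystems_iff_isPathArray {S : Finset (Fin n)} (h0 : ∃ i ∈ S, (i : ℕ) = 0)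
    (b : ℕ → Fin n → ℕ) : b ∈ pathSystems S n 0 (nextEnd S) ↔ IsPathArray S b := by
  rw [mem_pathSystems]
  constructor
  · rintro ⟨h1, h2⟩
    have hbox : ∀ q i, i ∈ S → q < (i : ℕ) →
        ((S.filter fun k : Fin n => q ≤ (k : ℕ) ∧ k < i).sup (consColumn (nextEnd S) b q)) < b q i ∧
          b q i ≤ consColumn (nextEnd S) b q i := by
      intro q i hi hq
      have := h1 q (hq.trans i.2) i
      rw [Nat.zero_add, interlaceBox, if_pos ⟨hi, hq⟩] at this
      exact Finset.mem_Ioc.1 this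
    refine ⟨fun q i hqi => ?_, fun q i hi hq => (Nat.zero_le _).trans_lt (hbox q i hi hq).1,
      fun i hi hpos => ?_, fun i hi hpos => (hbox 0 i hi hpos).2,
      fun q i hi hq => (hbox (q + 1) i hi hq).2, fun q i hi j hj hq hij => ?_⟩
    · by_cases hqn : q < n
      · have := h1 q hqn i
        rw [Nat.zero_add, interlaceBox, if_neg hqi] at this
        exact Finset.mem_singleton.1 this
      · exact h2 q (not_lt.1 hqn) i
    · have := (hbox 0 i hi hpos).1
      rwa [show consColumn (nextEnd S) b 0 = nextEnd S from rfl, sup_nextEnd h0 hi hpos] at this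
    · have hij' : (i : ℕ) < j := hij
      refine lt_of_le_of_lt ?_ (hbox (q + 1) j hj (by omega)).1
      exact Finset.le_sup (f := b q) (Finset.mem_filter.2 ⟨hi, hq, hij⟩)
  · intro hb
    refine ⟨fun q _ i => ?_, fun q hq i => hb.eq_zero q i fun hc => ?_⟩
    · rw [Nat.zero_add, interlaceBox]
      split_ifs with hi
      · rw [Finset.mem_Ioc]
        cases q with
        | zero =>
          rw [show consColumn (nextEnd S) b 0 = nextEnd S from rfl, sup_nextEnd h0 hi.1 hi.2]
          exact ⟨hb.lt_head i hi.1 hi.2, hb.head_le i hi.1 hi.2⟩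
        | succ q =>
          refine ⟨(Finset.sup_lt_iff (hb.pos _ i hi.1 hi.2)).2 fun k hk => ?_,
            hb.row_le q i hi.1 hi.2⟩
          obtain ⟨hk1, hk2, hk3⟩ := Finset.mem_filter.1 hk
          exact hb.col_lt q k hk1 i hi.1 hk2 hk3
      · exact Finset.mem_singleton.2 (hb.eq_zero q i hi)
    · have := i.2
      omega

theorem IsPathArray.le {S : Finset (Fin n)} {b : ℕ → Fin n → ℕ} (hb : IsPathArray S b)
    (q : ℕ) (i : Fin n) : b q i ≤ n := by
  by_cases h : i ∈ S ∧ q < (i : ℕ)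
  · obtain ⟨hi, hq⟩ := h
    induction q with
    | zero => exact (hb.head_le i hi hq).trans (nextEnd_le S i)
    | succ q ih => exact (hb.row_le q i hi hq).trans (ih (by omega))
  · rw [hb.eq_zero q i h]
    exact Nat.zero_le _

/-- The `k`-th largest element of `S`, counted from `1`. -/
noncomputable def nthLargest (S : Finset (Fin n)) (k : ℕ) : ℕ :=
  if h : 1 ≤ k ∧ k ≤ S.card then
    (S.orderEmbOfFin rfl ⟨S.card - k, by omega⟩ : Fin n) else 0

theorem nthLargest_mem (S : Finset (Fin n)) {k : ℕ} (h1 : 1 ≤ k) (h2 : k ≤ S.card) :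
    ∃ i ∈ S, (i : ℕ) = nthLargest S k := by
  rw [nthLargest, dif_pos ⟨h1, h2⟩]
  exact ⟨_, Finset.orderEmbOfFin_mem S rfl _, rfl⟩

theorem nthLargest_lt (S : Finset (Fin n)) {k l : ℕ} (h1 : 1 ≤ k) (h2 : k < l)
    (h3 : l ≤ S.card) : nthLargest S l < nthLargest S k := by
  rw [nthLargest, nthLargest, dif_pos ⟨by omega, h3⟩, dif_pos ⟨h1, by omega⟩]
  refine Fin.lt_def.1 ((S.orderEmbOfFin rfl).lt_iff_lt.2 (Fin.lt_def.2 ?_))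
  simp only
  omega

theorem exists_nthLargest_eq (S : Finset (Fin n)) {i : Fin n} (hi : i ∈ S) :
    ∃ k, 1 ≤ k ∧ k ≤ S.card ∧ nthLargest S k = i := by
  have h1 : i ∈ Set.range (S.orderEmbOfFin rfl) := by
    rw [Finset.range_orderEmbOfFin]
    exact hi
  obtain ⟨l, hl⟩ := h1
  have := l.2
  refine ⟨S.card - l, by omega, by omega, ?_⟩
  rw [nthLargest, dif_pos ⟨by omega, by omega⟩, ← hl]
  congr 2
  exact Fin.ext (by simp only; omega)

theorem nthLargest_card {S : Finset (Fin n)} (h0 : ∃ i ∈ S, (i : ℕ) = 0) :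
    nthLargest S S.card = 0 := by
  obtain ⟨i, hi, hi0⟩ := h0
  obtain ⟨k, hk1, hk2, hk⟩ := exists_nthLargest_eq S hi
  rcases hk2.eq_or_lt with rfl | hlt
  · rw [hk, hi0]
  · have := nthLargest_lt S hk1 hlt le_rfl
    omega

theorem eq_nthLargest {S : Finset (Fin n)} (f : ℕ → ℕ)
    (hf : ∀ k l, 1 ≤ k → k < l → l ≤ S.card → f l < f k)
    (hmem : ∀ k, 1 ≤ k → k ≤ S.card → ∃ i ∈ S, (i : ℕ) = f k) {k : ℕ} (h1 : 1 ≤ k)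
    (h2 : k ≤ S.card) : f k = nthLargest S k := by
  have : Nonempty (Fin n) := ⟨(hmem k h1 h2).choose⟩
  choose! g hgS hg using hmem
  have h3 := Finset.orderEmbOfFin_unique (s := S) rfl
    (f := fun l : Fin S.card => g (S.card - l))
    (fun l => hgS _ (by have := l.2; omega) (by omega)) (fun l m hlm => by
      have h4 : (l : ℕ) < m := hlm
      have h5 := m.2
      refine Fin.lt_def.2 ?_
      simp only
      rw [hg _ (by omega) (by omega), hg _ (by omega) (by omega)]
      exact hf _ _ (by omega) (by omega) (by omega))
  rw [nthLargest, dif_pos ⟨h1, h2⟩, ← h3]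
  simp only
  rw [hg _ (by omega) (by omega), Nat.sub_sub_self h2]

end Arrays

/-! ### Bijection between descending plane partitions and path arrays. -/

namespace DescendingPlanePartition

variable (A : DescendingPlanePartition)

/-- The number of parts of a row. -/
def rowLength (k : ℕ) : ℕ := A.μ k + 1 - k

theorem rowLength_pos {k : ℕ} (h1 : 1 ≤ k) (h2 : k ≤ A.r) : 0 < A.rowLength k := by
  have := A.row_nonempty k h1 h2
  rw [rowLength]
  omega

theorem rowLength_r_add_one : A.rowLength (A.r + 1) = 0 := by
  rw [rowLength, A.μ_eq_zero _ (by omega)]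
  omega

theorem rowLength_anti {k l : ℕ} (h1 : 1 ≤ k) (h2 : k < l) (h3 : l ≤ A.r + 1) :
    A.rowLength l < A.rowLength k := by
  change k + 1 ≤ l at h2
  induction l, h2 using Nat.le_induction with
  | base =>
    by_cases hk : k + 1 ≤ A.r
    · have h4 := A.μ_anti k h1 hk
      have h5 := A.row_nonempty k h1 (by omega)
      rw [rowLength, rowLength]
      omega
    · rw [show k + 1 = A.r + 1 by omega, rowLength_r_add_one]
      exact A.rowLength_pos h1 (by omega)
  | succ l hl ih =>
    refine lt_trans ?_ (ih (by omega))
    by_cases hk : l + 1 ≤ A.r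
    · have h4 := A.μ_anti l (by omega) hk
      have h5 := A.row_nonempty l (by omega) (by omega)
      rw [rowLength, rowLength]
      omega
    · rw [show l + 1 = A.r + 1 by omega, rowLength_r_add_one]
      exact A.rowLength_pos (by omega) (by omega)

variable {A}

theorem IsOfOrder.rowLength_lt {n : ℕ} (hA : A.IsOfOrder n) (hn : 1 ≤ n) {k : ℕ} (h1 : 1 ≤ k)
    (h2 : k ≤ A.r + 1) : A.rowLength k < n := by
  by_cases hk : k ≤ A.r
  · exact (A.rowLength_lt k h1 hk).trans_le (hA.a_le k k)
  · rw [show k = A.r + 1 by omega, rowLength_r_add_one]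
    exact hn

variable (A)

/-- Rows are shifted by one, so column strictness compares position `q` with position `q + 1` of the
row above. For distant rows, weak decrease along the intermediate rows absorbs the further shifts.
-/
theorem col_lt {k l q : ℕ} (h1 : 1 ≤ k) (h2 : k < l) (h3 : l ≤ A.r) (hq : q < A.rowLength l) :
    A.a l (l + q) < A.a k (k + (q + 1)) := by
  change k + 1 ≤ l at h2
  induction l, h2 using Nat.le_induction with
  | base =>
    rw [rowLength] at hq
    have := A.col_strict k (k + 1 + q) h1 h3 (by omega) (by omega)
    rwa [show k + (q + 1) = k + 1 + q by omega]
  | succ l hl ih =>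
    have hlt := A.rowLength_anti (k := l) (l := l + 1) (by omega) (by omega) (by omega)
    refine lt_trans ?_ (ih (by omega) (by omega))
    rw [rowLength] at hq
    rw [rowLength, rowLength] at hlt
    have h4 := A.col_strict l (l + 1 + q) (by omega) h3 (by omega) (by omega)
    have h5 := A.row_weak l (l + q) (by omega) (by omega) (by omega) (by omega)
    rw [show l + q + 1 = l + 1 + q by omega] at h5
    omega

/-- The set of the row lengths, including `0`. -/
def endSet (n : ℕ) : Finset (Fin n) :=
  Finset.univ.filter fun i => (i : ℕ) ∈ (Finset.Icc 1 (A.r + 1)).image A.rowLength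

/-- The parts, with rows labelled by their lengths. -/
def pathArray (n : ℕ) (q : ℕ) (i : Fin n) : ℕ :=
  ∑ k ∈ Finset.Icc 1 A.r, if A.rowLength k = i then A.a k (k + q) else 0

theorem mem_endSet {n : ℕ} {i : Fin n} :
    i ∈ A.endSet n ↔ ∃ k, 1 ≤ k ∧ k ≤ A.r + 1 ∧ A.rowLength k = i := by
  simp [endSet, and_assoc]

theorem exists_endSet_eq_zero {n : ℕ} (hn : 1 ≤ n) : ∃ i ∈ A.endSet n, (i : ℕ) = 0 :=
  ⟨⟨0, hn⟩, A.mem_endSet.2 ⟨A.r + 1, by omega, le_rfl, A.rowLength_r_add_one⟩, rfl⟩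

theorem exists_rowLength_eq {n : ℕ} {i : Fin n} (hi : i ∈ A.endSet n) (hpos : 0 < (i : ℕ)) :
    ∃ k, 1 ≤ k ∧ k ≤ A.r ∧ A.rowLength k = i := by
  obtain ⟨k, h1, h2, h3⟩ := A.mem_endSet.1 hi
  rcases h2.eq_or_lt with rfl | hlt
  · rw [rowLength_r_add_one] at h3
    omega
  · exact ⟨k, h1, by omega, h3⟩

theorem rowLength_injOn {k l : ℕ} (hk1 : 1 ≤ k) (hk2 : k ≤ A.r + 1) (hl1 : 1 ≤ l)
    (hl2 : l ≤ A.r + 1) (h : A.rowLength k = A.rowLength l) : k = l := by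
  rcases lt_trichotomy k l with hkl | hkl | hkl
  · have := A.rowLength_anti hk1 hkl hl2
    omega
  · exact hkl
  · have := A.rowLength_anti hl1 hkl hk2
    omega

theorem pathArray_apply {n : ℕ} (q : ℕ) {i : Fin n} {k : ℕ} (h1 : 1 ≤ k) (h2 : k ≤ A.r)
    (hi : A.rowLength k = i) : A.pathArray n q i = A.a k (k + q) := by
  rw [pathArray, Finset.sum_eq_single k, if_pos hi]
  · intro l hl hlk
    obtain ⟨hl1, hl2⟩ := Finset.mem_Icc.1 hl
    rw [if_neg]
    intro hli
    exact hlk (A.rowLength_injOn hl1 (by omega) h1 (by omega) (hli.trans hi.symm))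
  · intro hk
    exact absurd (Finset.mem_Icc.2 ⟨h1, h2⟩) hk

theorem pathArray_eq_zero {n : ℕ} (q : ℕ) {i : Fin n}
    (hi : ∀ k, 1 ≤ k → k ≤ A.r → A.rowLength k ≠ i) : A.pathArray n q i = 0 := by
  rw [pathArray]
  refine Finset.sum_eq_zero fun k hk => if_neg ?_
  obtain ⟨h1, h2⟩ := Finset.mem_Icc.1 hk
  exact hi k h1 h2

variable {A}

theorem IsOfOrder.isPathArray {n : ℕ} (hA : A.IsOfOrder n) :
    IsPathArray (A.endSet n) (A.pathArray n) := by
  refine ⟨fun q i hqi => ?_, fun q i hi hq => ?_, fun i hi hpos => ?_, fun i hi hpos => ?_,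
    fun q i hi hq => ?_, fun q i hi j hj hq hij => ?_⟩
  · by_cases h : ∃ k, 1 ≤ k ∧ k ≤ A.r ∧ A.rowLength k = i
    · obtain ⟨k, h1, h2, h3⟩ := h
      rw [A.pathArray_apply q h1 h2 h3]
      refine A.a_eq_zero _ _ fun hc => hqi ⟨A.mem_endSet.2 ⟨k, h1, by omega, h3⟩, ?_⟩
      rw [← h3, rowLength]
      omega
    · refine A.pathArray_eq_zero q fun k h1 h2 h3 => h ⟨k, h1, h2, h3⟩
  · obtain ⟨k, h1, h2, h3⟩ := A.exists_rowLength_eq hi (by omega)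
    rw [A.pathArray_apply q h1 h2 h3]
    rw [← h3, rowLength] at hq
    exact A.a_pos k _ h1 h2 (by omega) (by omega)
  · obtain ⟨k, h1, h2, h3⟩ := A.exists_rowLength_eq hi (by omega)
    rw [A.pathArray_apply 0 h1 h2 h3, ← h3]
    exact A.rowLength_lt k h1 h2
  · obtain ⟨k, h1, h2, h3⟩ := A.exists_rowLength_eq hi (by omega)
    rw [A.pathArray_apply 0 h1 h2 h3, Nat.add_zero]
    obtain ⟨h4, h5 | ⟨j, hj, h5⟩⟩ := nextEnd_mem (A.endSet n) i
    · rw [h5]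
      exact hA.a_le k k
    -- The next end is the length of some earlier row `l < k`. It need not be identified with row `k
    -- - 1`, since lengths decrease and the bound by row `k - 1` is at least as strong.
    · obtain ⟨l, hl1, hl2, hl3⟩ := A.exists_rowLength_eq hj (by omega)
      rw [← h5] at h4 ⊢
      have hlk : l < k := by
        by_contra hc
        rcases (not_lt.1 hc).eq_or_lt with rfl | hlt
        · omega
        · have := A.rowLength_anti h1 hlt (by omega)
          omega
      obtain ⟨k, rfl⟩ : ∃ k', k = k' + 1 := ⟨k - 1, by omega⟩
      refine (A.le_rowLength k (by omega) h2).trans ?_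
      rw [← hl3]
      rcases (Nat.lt_succ_iff.1 hlk).eq_or_lt with rfl | hlt
      · exact le_rfl
      · exact (A.rowLength_anti hl1 hlt (by omega)).le
  · obtain ⟨k, h1, h2, h3⟩ := A.exists_rowLength_eq hi (by omega)
    rw [A.pathArray_apply _ h1 h2 h3, A.pathArray_apply _ h1 h2 h3]
    rw [← h3, rowLength] at hq
    exact A.row_weak k (k + q) h1 h2 (by omega) (by omega)
  · have hij' : (i : ℕ) < j := hij
    obtain ⟨l, hl1, hl2, hl3⟩ := A.exists_rowLength_eq hi (by omega)
    obtain ⟨k, hk1, hk2, hk3⟩ := A.exists_rowLength_eq hj (by omega)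
    rw [A.pathArray_apply _ hl1 hl2 hl3, A.pathArray_apply _ hk1 hk2 hk3]
    have hkl : k < l := by
      by_contra hc
      rcases (not_lt.1 hc).eq_or_lt with rfl | hlt
      · omega
      · have := A.rowLength_anti hl1 hlt (by omega)
        omega
    exact A.col_lt hk1 hkl hl2 (by omega)

theorem IsOfOrder.card_endSet {n : ℕ} (hA : A.IsOfOrder n) (hn : 1 ≤ n) :
    (A.endSet n).card = A.r + 1 := by
  rw [show A.r + 1 = (Finset.Icc 1 (A.r + 1)).card by simp]
  symm
  refine Finset.card_bij (fun k hk => ⟨A.rowLength k, hA.rowLength_lt hn (Finset.mem_Icc.1 hk).1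
    (Finset.mem_Icc.1 hk).2⟩) (fun k hk => ?_) (fun k hk l hl hkl => ?_) (fun i hi => ?_)
  · rw [Finset.mem_Icc] at hk
    exact A.mem_endSet.2 ⟨k, hk.1, hk.2, rfl⟩
  · rw [Finset.mem_Icc] at hk hl
    exact A.rowLength_injOn hk.1 hk.2 hl.1 hl.2 (Fin.ext_iff.1 hkl)
  · obtain ⟨k, h1, h2, h3⟩ := A.mem_endSet.1 hi
    exact ⟨k, Finset.mem_Icc.2 ⟨h1, h2⟩, Fin.ext h3⟩

theorem IsOfOrder.rowLength_eq_nthLargest {n : ℕ} (hA : A.IsOfOrder n) (hn : 1 ≤ n) {k : ℕ}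
    (h1 : 1 ≤ k) (h2 : k ≤ A.r + 1) : A.rowLength k = nthLargest (A.endSet n) k := by
  refine eq_nthLargest A.rowLength (fun k l hk hkl hl => ?_) (fun k hk1 hk2 => ?_) h1 ?_
  · rw [hA.card_endSet hn] at hl
    exact A.rowLength_anti hk hkl hl
  · rw [hA.card_endSet hn] at hk2
    exact ⟨⟨A.rowLength k, hA.rowLength_lt hn hk1 hk2⟩, A.mem_endSet.2 ⟨k, hk1, hk2, rfl⟩, rfl⟩
  · rwa [hA.card_endSet hn]

theorem IsOfOrder.eq_of_pathArray_eq {n : ℕ} (hn : 1 ≤ n) {B : DescendingPlanePartition}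
    (hA : A.IsOfOrder n) (hB : B.IsOfOrder n) (hS : A.endSet n = B.endSet n)
    (hb : A.pathArray n = B.pathArray n) : A = B := by
  have hr : A.r = B.r := by
    have h1 := hA.card_endSet hn
    rw [hS, hB.card_endSet hn] at h1
    omega
  have hrow : ∀ k, 1 ≤ k → k ≤ A.r → A.rowLength k = B.rowLength k := fun k h1 h2 => by
    rw [hA.rowLength_eq_nthLargest hn h1 (by omega), hS,
      hB.rowLength_eq_nthLargest hn h1 (by omega)]
  have hμ : A.μ = B.μ := by
    funext k
    by_cases hk : 1 ≤ k ∧ k ≤ A.r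
    · have h1 := hrow k hk.1 hk.2
      have h2 := A.row_nonempty k hk.1 hk.2
      have h3 := B.row_nonempty k hk.1 (by omega)
      rw [rowLength, rowLength] at h1
      omega
    · rw [A.μ_eq_zero k hk, B.μ_eq_zero k (by omega)]
  refine DescendingPlanePartition.ext hr hμ ?_
  funext k j
  by_cases hk : 1 ≤ k ∧ k ≤ A.r ∧ k ≤ j ∧ j ≤ A.μ k
  · obtain ⟨h1, h2, h3, h4⟩ := hk
    obtain ⟨q, rfl⟩ : ∃ q, j = k + q := ⟨j - k, by omega⟩
    have h5 := hA.rowLength_lt hn h1 (by omega)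
    rw [← A.pathArray_apply (n := n) q (i := ⟨A.rowLength k, h5⟩) h1 h2 rfl, hb,
      B.pathArray_apply (n := n) q (i := ⟨A.rowLength k, h5⟩) h1 (by omega) (hrow k h1 h2).symm]
  · rw [A.a_eq_zero k j hk, B.a_eq_zero k j (by rwa [← hr, ← hμ])]

/-- The descending plane partition with given row lengths and parts. -/
def ofRows (r : ℕ) (len : ℕ → ℕ) (c : ℕ → ℕ → ℕ) (hlen : ∀ k, 1 ≤ k → k ≤ r → 0 < len k)
    (hanti : ∀ k, 1 ≤ k → k + 1 ≤ r → len (k + 1) < len k)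
    (hpos : ∀ k q, 1 ≤ k → k ≤ r → q < len k → 0 < c k q)
    (hrow : ∀ k q, 1 ≤ k → k ≤ r → q + 1 < len k → c k (q + 1) ≤ c k q)
    (hcol : ∀ k q, 1 ≤ k → k + 1 ≤ r → q < len (k + 1) → c (k + 1) q < c k (q + 1))
    (hlt : ∀ k, 1 ≤ k → k ≤ r → len k < c k 0)
    (hle : ∀ k, 1 ≤ k → k + 1 ≤ r → c (k + 1) 0 ≤ len k) : DescendingPlanePartition where
  r := r
  μ k := if 1 ≤ k ∧ k ≤ r then len k + k - 1 else 0
  a k j := if 1 ≤ k ∧ k ≤ r ∧ k ≤ j ∧ j < len k + k then c k (j - k) else 0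
  μ_eq_zero k hk := if_neg hk
  a_eq_zero k j hk := by
    refine if_neg fun hc => hk ⟨hc.1, hc.2.1, hc.2.2.1, ?_⟩
    rw [if_pos ⟨hc.1, hc.2.1⟩]
    omega
  row_nonempty k h1 h2 := by
    have := hlen k h1 h2
    rw [if_pos ⟨h1, h2⟩]
    omega
  a_pos k j h1 h2 h3 h4 := by
    rw [if_pos ⟨h1, h2⟩] at h4
    rw [if_pos (by omega)]
    exact hpos k _ h1 h2 (by omega)
  μ_anti k h1 h2 := by
    have := hanti k h1 h2
    rw [if_pos (by omega), if_pos (by omega)]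
    omega
  row_weak k j h1 h2 h3 h4 := by
    rw [if_pos ⟨h1, h2⟩] at h4
    rw [if_pos (by omega), if_pos (by omega), show j + 1 - k = j - k + 1 by omega]
    exact hrow k _ h1 h2 (by omega)
  col_strict k j h1 h2 h3 h4 := by
    have := hanti k h1 h2
    rw [if_pos (by omega)] at h4
    rw [if_pos (by omega), if_pos (by omega), show j - k = j - (k + 1) + 1 by omega]
    exact hcol k _ h1 h2 (by omega)
  rowLength_lt k h1 h2 := by
    have := hlen k h1 h2
    rw [if_pos ⟨h1, h2⟩, if_pos (by omega), Nat.sub_self]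
    have := hlt k h1 h2
    omega
  le_rowLength k h1 h2 := by
    have h3 := hlen k h1 (by omega)
    have h4 := hlen (k + 1) (by omega) h2
    rw [if_pos (by omega), if_pos (by omega), Nat.sub_self]
    have := hle k h1 h2
    omega

/-- The nonzero elements of `S`, in decreasing order, become the row lengths; the label `0` is a
phantom empty row, so there are `S.card - 1` rows. -/
theorem exists_pathArray_eq {n : ℕ} {S : Finset (Fin n)} (h0 : ∃ i ∈ S, (i : ℕ) = 0)
    {b : ℕ → Fin n → ℕ} (hb : IsPathArray S b) :
    ∃ A : DescendingPlanePartition, A.IsOfOrder n ∧ A.endSet n = S ∧ A.pathArray n = b := by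
  have hcard : 1 ≤ S.card := by
    obtain ⟨i, hi, -⟩ := h0
    exact Finset.card_pos.2 ⟨i, hi⟩
  have hn : ∀ k, 1 ≤ k → k ≤ S.card - 1 → ∃ i ∈ S, (i : ℕ) = nthLargest S k :=
    fun k h1 h2 => nthLargest_mem S h1 (by omega)
  have : Nonempty (Fin n) := ⟨h0.choose⟩
  choose! row hrowS hrow using hn
  have hpos : ∀ k, 1 ≤ k → k ≤ S.card - 1 → 0 < nthLargest S k := fun k h1 h2 => by
    have := nthLargest_lt S (k := k) (l := S.card) h1 (by omega) le_rfl
    omega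
  have hlt : ∀ k, 1 ≤ k → k + 1 ≤ S.card - 1 → row (k + 1) < row k := fun k h1 h2 => by
    rw [Fin.lt_def, hrow k h1 (by omega), hrow (k + 1) (by omega) h2]
    exact nthLargest_lt S h1 (by omega) (by omega)
  let A : DescendingPlanePartition := ofRows (S.card - 1) (nthLargest S) (fun k q => b q (row k))
    hpos (fun k h1 h2 => nthLargest_lt S h1 (by omega) (by omega))
    (fun k q h1 h2 hq => hb.pos q _ (hrowS k h1 h2) (by rwa [hrow k h1 h2]))
    (fun k q h1 h2 hq => hb.row_le q _ (hrowS k h1 h2) (by rwa [hrow k h1 h2]))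
    (fun k q h1 h2 hq => hb.col_lt q _ (hrowS _ (by omega) h2) _ (hrowS k h1 (by omega))
      (by rwa [hrow (k + 1) (by omega) h2]) (hlt k h1 h2))
    (fun k h1 h2 => by
      rw [← hrow k h1 h2]
      exact hb.lt_head _ (hrowS k h1 h2) (by rw [hrow k h1 h2]; exact hpos k h1 h2))
    (fun k h1 h2 => by
      rw [← hrow k h1 (by omega)]
      refine (hb.head_le _ (hrowS _ (by omega) h2) ?_).trans
        (nextEnd_le_of_mem (hrowS k h1 (by omega)) (hlt k h1 h2))
      rw [hrow _ (by omega) h2]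
      exact hpos _ (by omega) h2)
  have hAr : A.r = S.card - 1 := rfl
  have hAa : ∀ k j, A.a k j = if 1 ≤ k ∧ k ≤ S.card - 1 ∧ k ≤ j ∧ j < nthLargest S k + k then
      b (j - k) (row k) else 0 := fun _ _ => rfl
  have hAμ : ∀ k, A.μ k = if 1 ≤ k ∧ k ≤ S.card - 1 then nthLargest S k + k - 1 else 0 :=
    fun _ => rfl
  have hlen : ∀ k, 1 ≤ k → k ≤ S.card → A.rowLength k = nthLargest S k := by
    intro k h1 h2
    by_cases hk : k ≤ S.card - 1
    · have := hpos k h1 hk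
      rw [rowLength, hAμ, if_pos ⟨h1, hk⟩]
      omega
    · have hk' : k = S.card := by omega
      rw [hk', nthLargest_card h0, ← A.rowLength_r_add_one, hAr]
      congr 1
      omega
  have hend : A.endSet n = S := by
    ext i
    rw [mem_endSet, hAr]
    constructor
    · rintro ⟨k, h1, h2, h3⟩
      rw [hlen k h1 (by omega)] at h3
      obtain ⟨j, hj, hjk⟩ := nthLargest_mem S h1 (show k ≤ S.card by omega)
      rwa [← Fin.ext (hjk.trans h3)]
    · intro hi
      obtain ⟨k, h1, h2, h3⟩ := exists_nthLargest_eq S hi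
      exact ⟨k, h1, by omega, (hlen k h1 h2).trans h3⟩
  refine ⟨A, ?_, hend, ?_⟩
  · intro c _
    rw [hAa]
    split_ifs
    · exact hb.le _ _
    · exact Nat.zero_le _
  · funext q i
    by_cases hi : i ∈ S ∧ q < (i : ℕ)
    · rw [← hend] at hi
      obtain ⟨k, h1, h2, h3⟩ := A.exists_rowLength_eq hi.1 (by omega)
      rw [A.pathArray_apply q h1 h2 h3, hAa]
      rw [hAr] at h2
      rw [hlen k h1 (by omega)] at h3
      rw [if_pos (by omega), Nat.add_sub_cancel_left,
        show row k = i from Fin.ext ((hrow k h1 h2).trans h3)]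
    · rw [hb.eq_zero q i hi]
      by_cases h : ∃ k, 1 ≤ k ∧ k ≤ A.r ∧ A.rowLength k = i
      · obtain ⟨k, h1, h2, h3⟩ := h
        rw [A.pathArray_apply q h1 h2 h3, hAa]
        rw [hAr] at h2
        have hiS : i ∈ S := by
          rw [← hend, mem_endSet]
          exact ⟨k, h1, by omega, h3⟩
        rw [hlen k h1 (by omega)] at h3
        refine if_neg fun hc => hi ⟨hiS, by omega⟩
      · exact A.pathArray_eq_zero q fun k h1 h2 h3 => h ⟨k, h1, h2, h3⟩

theorem weight_eq_prod_partWeight {R : Type*} [CommRing R] (A : DescendingPlanePartition) (n : ℕ)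
    (x y z : R) :
    x ^ A.numSpecial * y ^ A.numNonspecial * z ^ A.numMax n =
      ∏ k ∈ Finset.Icc 1 A.r, ∏ q ∈ Finset.range (A.rowLength k),
        partWeight n x y z q (A.a k (k + q)) := by
  have h1 : ∀ k, ∏ q ∈ Finset.range (A.rowLength k), partWeight n x y z q (A.a k (k + q)) =
      ∏ j ∈ Finset.Icc k (A.μ k), partWeight n x y z (j - k) (A.a k j) := by
    intro k
    rw [show Finset.Icc k (A.μ k) = Finset.Ico k (A.μ k + 1) by ext; simp,
      Finset.prod_Ico_eq_prod_range]
    refine Finset.prod_congr rfl fun q _ => ?_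
    rw [Nat.add_sub_cancel_left]
  rw [Finset.prod_congr rfl fun k _ => h1 k, Finset.prod_sigma',
    show (Finset.Icc 1 A.r).sigma (fun k => Finset.Icc k (A.μ k)) = A.cells from rfl]
  simp only [partWeight]
  rw [Finset.prod_mul_distrib, Finset.prod_ite, Finset.prod_ite]
  simp only [Finset.prod_const, one_pow, mul_one]
  rfl

theorem IsOfOrder.weight_eq_prod_columnWeight {R : Type*} [CommRing R] {n : ℕ} (hn : 1 ≤ n)
    (hA : A.IsOfOrder n) (x y z : R) :
    x ^ A.numSpecial * y ^ A.numNonspecial * z ^ A.numMax n =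
      ∏ q ∈ Finset.range n, columnWeight x y z (A.endSet n) q (A.pathArray n q) := by
  have h1 : ∀ i : Fin n, ∏ q ∈ Finset.range n, (if i ∈ A.endSet n ∧ q < (i : ℕ) then
      partWeight n x y z q (A.pathArray n q i) else 1) = if i ∈ A.endSet n then
        ∏ q ∈ Finset.range i, partWeight n x y z q (A.pathArray n q i) else 1 := by
    intro i
    split_ifs with hi
    · rw [← Finset.prod_subset (Finset.range_subset_range.2 i.2.le)]
      · refine Finset.prod_congr rfl fun q hq => ?_
        rw [if_pos ⟨hi, Finset.mem_range.1 hq⟩]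
      · intro q _ hq
        rw [if_neg fun hc => hq (Finset.mem_range.2 hc.2)]
    · exact Finset.prod_eq_one fun q _ => if_neg fun hc => hi hc.1
  simp only [columnWeight]
  rw [Finset.prod_comm, Finset.prod_congr rfl fun i _ => h1 i, Finset.prod_ite_mem,
    Finset.univ_inter, weight_eq_prod_partWeight]
  -- The phantom row `A.r + 1`, of length `0`, is added with an empty product so that rows match all
  -- of `endSet`.
  have h2 : ∏ k ∈ Finset.Icc 1 A.r, ∏ q ∈ Finset.range (A.rowLength k),
      partWeight n x y z q (A.a k (k + q)) =
      ∏ k ∈ Finset.Icc 1 (A.r + 1), ∏ q ∈ Finset.range (A.rowLength k),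
        partWeight n x y z q (A.a k (k + q)) := by
    rw [Finset.prod_Icc_succ_top (by omega), rowLength_r_add_one]
    simp
  rw [h2]
  refine Finset.prod_bij (fun k hk => ⟨A.rowLength k, hA.rowLength_lt hn (Finset.mem_Icc.1 hk).1
    (Finset.mem_Icc.1 hk).2⟩) (fun k hk => ?_) (fun k hk l hl hkl => ?_) (fun i hi => ?_)
    fun k hk => ?_
  · rw [Finset.mem_Icc] at hk
    exact A.mem_endSet.2 ⟨k, hk.1, hk.2, rfl⟩
  · rw [Finset.mem_Icc] at hk hl
    exact A.rowLength_injOn hk.1 hk.2 hl.1 hl.2 (Fin.ext_iff.1 hkl)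
  · obtain ⟨k, h1, h2, h3⟩ := A.mem_endSet.1 hi
    exact ⟨k, Finset.mem_Icc.2 ⟨h1, h2⟩, Fin.ext h3⟩
  · obtain ⟨hk1, hk2⟩ := Finset.mem_Icc.1 hk
    rcases hk2.eq_or_lt with rfl | hlt
    · simp [rowLength_r_add_one]
    · refine Finset.prod_congr rfl fun q _ => ?_
      rw [A.pathArray_apply q hk1 (by omega) rfl]

end DescendingPlanePartition

/-! ### The partition function as a sum over path systems, and the conclusion. -/

theorem ZDPP_eq_sum_pathSystems {R : Type*} [CommRing R] (m : ℕ) (x y z : R) :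
    ZDPP (m + 1) x y z = ∑ S : Finset (Fin (m + 1)), if 0 ∈ S then
      ∑ b ∈ pathSystems S (m + 1) 0 (nextEnd S),
        ∏ q ∈ Finset.range (m + 1), columnWeight x y z S q (b q) else 0 := by
  rw [ZDPP, ← Finset.sum_filter, Finset.sum_sigma']
  have hzero : ∀ S : Finset (Fin (m + 1)), 0 ∈ S ↔ ∃ i ∈ S, (i : ℕ) = 0 := fun S =>
    ⟨fun h => ⟨0, h, rfl⟩, fun ⟨i, hi, hi0⟩ => by rwa [← show i = 0 from Fin.ext hi0]⟩
  refine Finset.sum_bij (fun A _ => ⟨A.1.endSet (m + 1), A.1.pathArray (m + 1)⟩)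
    (fun A _ => ?_) (fun A _ B _ hAB => ?_) (fun c hc => ?_) fun A _ => ?_
  · have h0 := A.1.exists_endSet_eq_zero (n := m + 1) (by omega)
    simp only [Finset.mem_sigma, Finset.mem_filter, Finset.mem_univ, true_and]
    exact ⟨(hzero _).2 h0, (mem_pathSystems_iff_isPathArray h0 _).2 A.2.isPathArray⟩
  · simp only [Sigma.mk.injEq, heq_eq_eq] at hAB
    exact Subtype.ext (A.2.eq_of_pathArray_eq (by omega) B.2 hAB.1 hAB.2)
  · obtain ⟨S, b⟩ := c
    simp only [Finset.mem_sigma, Finset.mem_filter, Finset.mem_univ, true_and] at hc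
    have h0 := (hzero S).1 hc.1
    obtain ⟨A, hA, hS, hb⟩ := DescendingPlanePartition.exists_pathArray_eq h0
      ((mem_pathSystems_iff_isPathArray h0 b).1 hc.2)
    refine ⟨⟨A, hA⟩, Finset.mem_univ _, ?_⟩
    simp only [hS, hb]
  · exact A.2.weight_eq_prod_columnWeight (by omega) x y z

theorem mainTheorem5 {R : Type*} [CommRing R] (n : ℕ) (hn : 1 ≤ n) (x y z ν : R)
    (hν : x * ν * (1 - ν) = ν + y * (1 - ν)) :
    (1 + ν * (z - 1)) * ZDPP n x y z = (truncate (MDPP' n x y z ν) n).det := by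
  rw [det_truncate_MDPP' n hn]
  obtain ⟨m, rfl⟩ : ∃ m, n = m + 1 := ⟨n - 1, by omega⟩
  rw [ZDPP_eq_sum_pathSystems, det_sub_shift m (pathWeight (m + 1) x y z 0)]
  simp only [det_nextEnd]
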